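/- For $\alpha>0$ and $L\ge 0$ let $\phi_{\alpha,L}(x)=\exp(\min\{x^2,(x/L)^\alpha\})-1$ for $x\ge 0$ (with $\phi_{\alpha,0}(x)=\exp(x^2)-1$), and let $\|X\|_{\phi_{\alpha,L}}=\inf\{\eta>0:\mathbb E[\phi_{\alpha,L}(|X|/\eta)]\le 1\}$ for a real random variable $X$. For $L=(L_1,\dots,L_n)$ with $L_i\ge 0$ let $\mathcal X_{\alpha,L}$ be the collection of all families $(X_1,\dots,X_n)$ of independent mean-zero random variables with $\|X_i\|_{\phi_{\alpha,L_i}}\le 1$ for all $i$. Put $\bar L_i=\max\{1,L_i\}$. Theorem. For every $\alpha>0$ there is a constant $C(\alpha)\in(0,\infty)$, depending only on $\alpha$, such that the following holds for all $n$, all $L_1,\dots,L_n\ge 0$, all $a_1,\dots,a_n\ge 0$ with $a_1\bar L_1\ge\dots\ge a_n\bar L_n$, and all real $p\ge 1$. Let $$M=\max\left\{\sqrt p\,\Big(\sum_{i=1}^n (a_i\bar L_i)^2\Big)^{1/2},\; p^{1/\alpha}N\right\},$$ where $N=\big(\sum_{i\le \min(p,n)}(a_iL_i)^{\beta}\big)^{1/\beta}$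 with $\beta=\frac{\alpha}{\alpha-1}$ if $\alpha>1$, and $N=\max_{1\le i\le n}a_iL_i$ (the case $\beta=\infty$) if $\alpha\le 1$. Then $$\sup_{(X_1,\dots,X_n)\in\mathcal X_{\alpha,L}}\Big\|\sum_{i=1}^n a_iX_i\Big\|_p\;\le\; C(\alpha)\,M ,$$ and the bound is tight: if $\alpha\le 2$, then $$\sup_{(X_1,\dots,X_n)\in\mathcal X_{\alpha,L}}\Big\|\sum_{i=1}^n a_iX_i\Big\|_p\;\ge\;\frac{1}{C(\alpha)}\,M .$$ -/

import Mathlib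

open MeasureTheory ProbabilityTheory
open scoped ENNReal

universe u

noncomputable section

namespace GBO


/-- The `g`-Orlicz norm `inf {η > 0 : E[g(|X|/η)] ≤ 1}` of a real random variable, as an extended
nonnegative number (it is `∞` when no such `η` exists). Only the values of `g` on `[0, ∞)`, which
are meant to be nonnegative, matter. -/
def orliczNorm {Ω : Type u} [MeasurableSpace Ω] (g : ℝ → ℝ) (X : Ω → ℝ) (P : Measure Ω) : ℝ≥0∞ :=
  ⨅ (η : ℝ) (_ : 0 < η) (_ : ∫⁻ ω, ENNReal.ofReal (g (|X ω| / η)) ∂P ≤ 1), ENNReal.ofReal η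

/-- `φ_{α,L}(x) = exp (min {x², (x/L)^α}) - 1` for `x ≥ 0`. For `L = 0` the convention
`(x/0)^α = ∞` for `x > 0` gives `exp (x²) - 1`. -/
def phi (α L x : ℝ) : ℝ :=
  Real.exp (if L = 0 then x ^ 2 else min (x ^ 2) ((x / L) ^ α)) - 1

/-- The class `𝒳_{α,L}` on a given probability space: independent mean-zero real random variables
`X_1, …, X_n` with `‖X_i‖_{φ_{α,L_i}} ≤ 1`. -/
structure MemClass {Ω : Type u} [MeasurableSpace Ω] (P : Measure Ω) {n : ℕ} (α : ℝ)
    (L : Fin n → ℝ) (X : Fin n → Ω → ℝ) : Prop where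
  measurable : ∀ i, Measurable (X i)
  integrable : ∀ i, Integrable (X i) P
  mean_zero : ∀ i, ∫ ω, X i ω ∂P = 0
  norm_le_one : ∀ i, orliczNorm (phi α (L i)) (X i) P ≤ 1
  indep : iIndepFun X P

/-- `sup ‖∑ a_i X_i‖_p` over all probability spaces and all `(X_1, …, X_n) ∈ 𝒳_{α,L}`. -/
def worstMoment {n : ℕ} (α : ℝ) (L a : Fin n → ℝ) (p : ℝ) : ℝ≥0∞ :=
  ⨆ (Ω : Type u) (_ : MeasurableSpace Ω) (P : Measure Ω) (_ : IsProbabilityMeasure P)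
    (X : Fin n → Ω → ℝ) (_ : MemClass P α L X),
    eLpNorm (fun ω => ∑ i, a i * X i ω) (ENNReal.ofReal p) P

/-- The `ℓ^r` norm of a vector in `ℝⁿ`. -/
def vecNorm {n : ℕ} (r : ℝ≥0∞) (v : Fin n → ℝ) : ℝ := ‖WithLp.toLp r v‖

/-- `β = α / (α - 1)` for `α > 1` and `β = ∞` for `α ≤ 1`. -/
def conjExp (α : ℝ) : ℝ≥0∞ := if 1 < α then ENNReal.ofReal (α / (α - 1)) else ∞

/-- `L̄_i = max {1, L_i}`. -/
def Lbar {n : ℕ} (L : Fin n → ℝ) (i : Fin n) : ℝ := max 1 (L i)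

/-- The vector whose `ℓ^β` norm enters the Weibull part of the bound: for `α > 1` it is
`(a_i L_i : i ≤ p)` (with `i = 1, …, n`, padded by zeros, which do not change the norm), and for
`α ≤ 1` it is all of `a ⊙ L`. -/
def heavyPart {n : ℕ} (α : ℝ) (L a : Fin n → ℝ) (p : ℝ) (i : Fin n) : ℝ :=
  if α ≤ 1 ∨ ((i : ℕ) : ℝ) + 1 ≤ p then a i * L i else 0

/-- The right-hand side `max {√p ‖a ⊙ L̄‖₂, p^{1/α} ‖·‖_β}` of the moment bounds. -/
def momentBound {n : ℕ} (α : ℝ) (L a : Fin n → ℝ) (p : ℝ) : ℝ :=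
  max (Real.sqrt p * vecNorm 2 (fun i => a i * Lbar L i))
    (p ^ (1 / α) * vecNorm (conjExp α) (heavyPart α L a p))

end GBO

end

namespace GBO

/-! Upper bound. Put U_i = min{x², (x/L_i)^α} at x = |X_i|/2. The norm condition gives E exp(U_i) ≤
2, and inverting the minimum gives |X_i|/2 ≤ U_i^(1/2) + L_i U_i^(1/α). The index set is cut at p.

Head, at most p indices: Hölder duality bounds ∑ a_i|X_i| by a multiple of ‖a ⊙ L̄‖₂ S^(1/2) + N
S^(1/α), where S = ∑ U_i and N is the ℓ^β norm in the bound. Independence gives E exp(S) ≤ 2^p,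
hence ‖S^s‖_p ≤ 2(sp)^s (`eLpNorm_sum_le_of_card_le`).

Tail: by monotonicity √p a_i L̄_i ≤ ‖a ⊙ L̄‖₂, so every coefficient is small on the scale M/p. For
an even q comparable to p, expand E(∑ Y_i)^q. Centring kills the first-order terms, leaving at most
∏(1 + ∑_{j ≥ 2} C(q,j) E|Y_i|^j). Smallness makes each inner sum geometric, of the size of its
quadratic term; these add up to O(q), and the q-th root is a constant (`abs_integral_sum_pow_le`,
`sum_choose_mul_moment_le`, `eLpNorm_tail_le`).

Lower bound: each half of the maximum has its own extremal family. For the Weibull half, symmetric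
three-point variables reach their top values simultaneously with probability at least (2e)^(-p), and
those values follow the equality case of Hölder (`exists_dual_weights`). For the Gaussian half, X_i
is a small multiple of L̄_i times a standard Gaussian, which is admissible because α ≤ 2
(`phiExp_gaussian_le`). -/

/-! ### The exponent of the Orlicz function and exponential moments -/

/-- The exponent `min {x², (x/L)^α}` occurring in `phi`. -/
noncomputable def phiExp (α L x : ℝ) : ℝ := if L = 0 then x ^ 2 else min (x ^ 2) ((x / L) ^ α)

lemma phi_eq (α L x : ℝ) : phi α L x = Real.exp (phiExp α L x) - 1 := rfl

lemma phiExp_nonneg {α L x : ℝ} (hL : 0 ≤ L) (hx : 0 ≤ x) : 0 ≤ phiExp α L x := by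
  unfold phiExp
  split_ifs
  · positivity
  · exact le_min (by positivity) (by positivity)

lemma phiExp_mono {α L x y : ℝ} (hα : 0 < α) (hL : 0 ≤ L) (hx : 0 ≤ x) (hxy : x ≤ y) :
    phiExp α L x ≤ phiExp α L y := by
  unfold phiExp
  split_ifs
  · gcongr
  · exact min_le_min (by gcongr) (by gcongr)

lemma measurable_phiExp (α L : ℝ) : Measurable (phiExp α L) := by
  unfold phiExp
  split_ifs
  · fun_prop
  · fun_prop

/-- Whichever branch attains the minimum, the matching term on the right equals x and the other is
nonnegative. -/
lemma le_sqrt_phiExp_add {α L x : ℝ} (hα : 0 < α) (hL : 0 ≤ L) (hx : 0 ≤ x) :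
    x ≤ (phiExp α L x) ^ (1 / 2 : ℝ) + L * (phiExp α L x) ^ (1 / α) := by
  have h0 := phiExp_nonneg (α := α) hL hx
  have hsq : (x ^ 2) ^ (1 / 2 : ℝ) = x := by rw [← Real.sqrt_eq_rpow, Real.sqrt_sq hx]
  have h1 : 0 ≤ (phiExp α L x) ^ (1 / 2 : ℝ) := by positivity
  have h2 : 0 ≤ L * (phiExp α L x) ^ (1 / α) := by positivity
  rcases eq_or_ne L 0 with hL0 | hL0
  · have : phiExp α L x = x ^ 2 := by simp [phiExp, hL0]
    rw [this] at h2 ⊢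
    rw [hsq]
    linarith
  · rcases min_choice (x ^ 2) ((x / L) ^ α) with h | h
    · have : phiExp α L x = x ^ 2 := by simp only [phiExp, hL0, if_false, h]
      rw [this] at h2 ⊢
      rw [hsq]
      linarith
    · have : phiExp α L x = (x / L) ^ α := by simp only [phiExp, hL0, if_false, h]
      have h3 : L * (phiExp α L x) ^ (1 / α) = x := by
        rw [this, ← Real.rpow_mul (by positivity), mul_one_div_cancel hα.ne', Real.rpow_one]
        field_simp
      linarith

/-- Norm at most 1 only provides admissible η arbitrarily close to 1 or below. Dividing by 2 leaves
room for one such η < 2, so attainment of the infimum is not needed. -/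
lemma lintegral_exp_phiExp_le_two {Ω : Type u} [MeasurableSpace Ω] {P : Measure Ω}
    [IsProbabilityMeasure P] {α L : ℝ} (hα : 0 < α) (hL : 0 ≤ L) {X : Ω → ℝ}
    (h : orliczNorm (phi α L) X P ≤ 1) :
    ∫⁻ ω, ENNReal.ofReal (Real.exp (phiExp α L (|X ω| / 2))) ∂P ≤ 2 := by
  have h2 : orliczNorm (phi α L) X P < 2 := h.trans_lt (by norm_num)
  simp only [orliczNorm, iInf_lt_iff] at h2
  obtain ⟨η, hη, hint, hlt⟩ := h2
  have hη2 : η < 2 := by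
    rwa [show (2 : ℝ≥0∞) = ENNReal.ofReal 2 by simp, ENNReal.ofReal_lt_ofReal_iff (by norm_num)]
      at hlt
  calc ∫⁻ ω, ENNReal.ofReal (Real.exp (phiExp α L (|X ω| / 2))) ∂P
      ≤ ∫⁻ ω, (ENNReal.ofReal (phi α L (|X ω| / η)) + 1) ∂P := by
        apply lintegral_mono
        intro ω
        have hm : phiExp α L (|X ω| / 2) ≤ phiExp α L (|X ω| / η) :=
          phiExp_mono hα hL (by positivity) (by gcongr)
        have h0 : 0 ≤ phiExp α L (|X ω| / η) := phiExp_nonneg hL (by positivity)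
        have h1 := Real.one_le_exp h0
        simp only
        rw [show (1 : ℝ≥0∞) = ENNReal.ofReal 1 by simp, ← ENNReal.ofReal_add _ (by norm_num)]
        · apply ENNReal.ofReal_le_ofReal
          rw [phi_eq]
          simpa using hm
        · rw [phi_eq]; linarith
    _ = ∫⁻ ω, ENNReal.ofReal (phi α L (|X ω| / η)) ∂P + 1 := by
        rw [lintegral_add_right _ measurable_const]; simp
    _ ≤ 1 + 1 := by gcongr
    _ = 2 := one_add_one_eq_two

lemma integral_exp_phiExp_le_two {Ω : Type u} [MeasurableSpace Ω] {P : Measure Ω}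
    [IsProbabilityMeasure P] {α L : ℝ} (hα : 0 < α) (hL : 0 ≤ L) {X : Ω → ℝ} (hX : Measurable X)
    (h : orliczNorm (phi α L) X P ≤ 1) :
    Integrable (fun ω => Real.exp (phiExp α L (|X ω| / 2))) P ∧
    ∫ ω, Real.exp (phiExp α L (|X ω| / 2)) ∂P ≤ 2 := by
  have h1 := lintegral_exp_phiExp_le_two hα hL h
  have hm : Measurable (fun ω => Real.exp (phiExp α L (|X ω| / 2))) := by
    have := measurable_phiExp α L
    fun_prop
  refine ⟨⟨hm.aestronglyMeasurable, ?_⟩, ?_⟩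
  · rw [hasFiniteIntegral_iff_ofReal (Filter.Eventually.of_forall fun ω => (Real.exp_pos _).le)]
    exact h1.trans_lt (by norm_num)
  · rw [integral_eq_lintegral_of_nonneg_ae (Filter.Eventually.of_forall fun ω => (Real.exp_pos _).le)
      hm.aestronglyMeasurable]
    exact ENNReal.toReal_le_of_le_ofReal (by norm_num) (by simpa using h1)

/-- Raise x/s ≤ exp(x/s) to the power s; for s = 0 the convention 0^0 = 1 applies. -/
lemma rpow_le_rpow_self_mul_exp {s x : ℝ} (hs : 0 ≤ s) (hx : 0 ≤ x) :
    x ^ s ≤ s ^ s * Real.exp x := by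
  rcases hs.eq_or_lt with rfl | hs
  · simp [hx]
  · have h1 : x / s ≤ Real.exp (x / s) := by linarith [Real.add_one_le_exp (x / s)]
    calc x ^ s = s ^ s * (x / s) ^ s := by
          rw [← Real.mul_rpow hs.le (by positivity)]; field_simp
      _ ≤ s ^ s * (Real.exp (x / s)) ^ s := by gcongr
      _ = s ^ s * Real.exp x := by rw [← Real.exp_mul]; field_simp

/-- `‖S^s‖_p ≤ K (s p)^s` as soon as `E exp S ≤ K^p`. -/
lemma eLpNorm_rpow_le {Ω : Type u} [MeasurableSpace Ω] {P : Measure Ω} {S : Ω → ℝ}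
    (hS0 : ∀ ω, 0 ≤ S ω) {s p K : ℝ} (hs : 0 ≤ s) (hp : 1 ≤ p) (hK : 0 ≤ K)
    (hE : ∫⁻ ω, ENNReal.ofReal (Real.exp (S ω)) ∂P ≤ ENNReal.ofReal (K ^ p)) :
    eLpNorm (fun ω => S ω ^ s) (ENNReal.ofReal p) P ≤ ENNReal.ofReal (K * (s * p) ^ s) := by
  have hp0 : 0 < p := by linarith
  rw [eLpNorm_eq_lintegral_rpow_enorm_toReal (by simpa using hp0) (by simp),
    ENNReal.toReal_ofReal hp0.le]
  have h1 : ∫⁻ ω, ‖S ω ^ s‖ₑ ^ p ∂P ≤ ENNReal.ofReal ((K * (s * p) ^ s) ^ p) := by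
    calc ∫⁻ ω, ‖S ω ^ s‖ₑ ^ p ∂P
        ≤ ∫⁻ ω, ENNReal.ofReal ((s * p) ^ (s * p)) * ENNReal.ofReal (Real.exp (S ω)) ∂P := by
          apply lintegral_mono
          intro ω
          have h0 := hS0 ω
          simp only
          rw [Real.enorm_of_nonneg (by positivity), ENNReal.ofReal_rpow_of_nonneg (by positivity)
            hp0.le, ← Real.rpow_mul h0, ← ENNReal.ofReal_mul (by positivity)]
          exact ENNReal.ofReal_le_ofReal (rpow_le_rpow_self_mul_exp (by positivity) h0)
      _ = ENNReal.ofReal ((s * p) ^ (s * p)) * ∫⁻ ω, ENNReal.ofReal (Real.exp (S ω)) ∂P :=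
          lintegral_const_mul' _ _ ENNReal.ofReal_ne_top
      _ ≤ ENNReal.ofReal ((s * p) ^ (s * p)) * ENNReal.ofReal (K ^ p) := by gcongr
      _ = ENNReal.ofReal ((K * (s * p) ^ s) ^ p) := by
          rw [← ENNReal.ofReal_mul (by positivity), Real.mul_rpow hK (by positivity),
            ← Real.rpow_mul (by positivity), mul_comm]
  calc _ ≤ (ENNReal.ofReal ((K * (s * p) ^ s) ^ p)) ^ (1 / p) := by gcongr
    _ = _ := by
      rw [ENNReal.ofReal_rpow_of_nonneg (by positivity) (by positivity),
        ← Real.rpow_mul (by positivity), mul_one_div_cancel hp0.ne', Real.rpow_one]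

/-! ### Moments and exponential moments of independent sums -/

/-- Used with g m = |E Y^m| and h m = E|Y|^m: the index 1 contributes nothing for a centred
variable, and enlarging r to q makes the bound independent of r. -/
lemma sum_choose_mul_le {q r : ℕ} (hrq : r ≤ q) {g h : ℕ → ℝ} (hg0 : g 0 ≤ 1) (hg1 : g 1 = 0)
    (hg : ∀ m, 0 ≤ g m) (hgh : ∀ m, g m ≤ h m) :
    ∑ m ∈ Finset.range (r + 1), (r.choose m : ℝ) * g m ≤
      1 + ∑ m ∈ Finset.Icc 2 q, (q.choose m : ℝ) * h m := by
  have hsub : Finset.range (r + 1) ⊆ insert 0 (insert 1 (Finset.Icc 2 q)) := by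
    intro m hm
    simp only [Finset.mem_range, Finset.mem_insert, Finset.mem_Icc] at *
    omega
  calc ∑ m ∈ Finset.range (r + 1), (r.choose m : ℝ) * g m
      ≤ ∑ m ∈ insert 0 (insert 1 (Finset.Icc 2 q)), (r.choose m : ℝ) * g m :=
        Finset.sum_le_sum_of_subset_of_nonneg hsub fun m _ _ => by have := hg m; positivity
    _ = g 0 + ∑ m ∈ Finset.Icc 2 q, (r.choose m : ℝ) * g m := by
        rw [Finset.sum_insert (by simp), Finset.sum_insert (by simp), hg1]
        simp
    _ ≤ _ := by
        gcongr with m hm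
        · exact hg m
        · exact hgh m

variable {Ω : Type u} [MeasurableSpace Ω] {P : Measure Ω}

/-- Moments of a sum of independent centred variables: terms of first order drop out of the
binomial expansion. -/
lemma abs_integral_sum_pow_le {ι : Type*} [IsProbabilityMeasure P] {Y : ι → Ω → ℝ}
    (hind : iIndepFun Y P) (hm : ∀ i, Measurable (Y i))
    (hint : ∀ i (j : ℕ), Integrable (fun ω => |Y i ω| ^ j) P) (hmean : ∀ i, ∫ ω, Y i ω ∂P = 0)
    (q : ℕ) (s : Finset ι) :
    ∀ r ≤ q, Integrable (fun ω => (∑ i ∈ s, Y i ω) ^ r) P ∧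
      |∫ ω, (∑ i ∈ s, Y i ω) ^ r ∂P| ≤
        ∏ i ∈ s, (1 + ∑ j ∈ Finset.Icc 2 q, (q.choose j : ℝ) * ∫ ω, |Y i ω| ^ j ∂P) := by
  classical
  have hint' : ∀ i (j : ℕ), Integrable (fun ω => Y i ω ^ j) P := fun i j =>
    (hint i j).mono ((hm i).pow_const j).aestronglyMeasurable
      (Filter.Eventually.of_forall fun ω => by simp)
  -- Splitting off one variable turns the power r into all powers r - m, so the induction carries
  -- every r ≤ q with one common bound.
  induction s using Finset.induction_on with
  | empty =>
    intro r _
    rcases Nat.eq_zero_or_pos r with rfl | h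
    · simp
    · simp [h.ne']
  | insert i s his ih =>
    intro r hr
    set B := ∏ i ∈ s, (1 + ∑ j ∈ Finset.Icc 2 q, (q.choose j : ℝ) * ∫ ω, |Y i ω| ^ j ∂P)
    have hI : IndepFun (fun ω => ∑ j ∈ s, Y j ω) (Y i) P := by
      have := hind.indepFun_finsetSum_of_notMem hm his
      convert this using 1
      ext ω
      simp
    have hIm : ∀ m k : ℕ, IndepFun (fun ω => Y i ω ^ m) (fun ω => (∑ j ∈ s, Y j ω) ^ k) P :=
      fun m k => hI.symm.comp (φ := fun x => x ^ m) (ψ := fun x => x ^ k)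
        (by fun_prop) (by fun_prop)
    have hexp : ∀ ω, (∑ j ∈ insert i s, Y j ω) ^ r = ∑ m ∈ Finset.range (r + 1),
        (Y i ω ^ m * (∑ j ∈ s, Y j ω) ^ (r - m)) * (r.choose m : ℝ) := by
      intro ω
      rw [Finset.sum_insert his, add_pow]
    have hti : ∀ m ∈ Finset.range (r + 1), Integrable (fun ω =>
        (Y i ω ^ m * (∑ j ∈ s, Y j ω) ^ (r - m)) * (r.choose m : ℝ)) P := fun m _ =>
      ((hIm m (r - m)).integrable_mul (hint' i m) (ih (r - m) (by omega)).1).mul_const _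
    simp_rw [hexp]
    refine ⟨integrable_finsetSum _ hti, ?_⟩
    rw [integral_finsetSum _ hti, Finset.prod_insert his]
    have hB : 0 ≤ B := Finset.prod_nonneg fun k _ => by
      have : 0 ≤ ∑ j ∈ Finset.Icc 2 q, (q.choose j : ℝ) * ∫ ω, |Y k ω| ^ j ∂P :=
        Finset.sum_nonneg fun j _ => mul_nonneg (by positivity)
          (integral_nonneg fun ω => by positivity)
      linarith
    calc |∑ m ∈ Finset.range (r + 1), ∫ ω, (Y i ω ^ m * (∑ j ∈ s, Y j ω) ^ (r - m)) *
            (r.choose m : ℝ) ∂P|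
        ≤ ∑ m ∈ Finset.range (r + 1), |∫ ω, (Y i ω ^ m * (∑ j ∈ s, Y j ω) ^ (r - m)) *
            (r.choose m : ℝ) ∂P| := Finset.abs_sum_le_sum_abs _ _
      _ ≤ ∑ m ∈ Finset.range (r + 1), ((r.choose m : ℝ) * |∫ ω, Y i ω ^ m ∂P|) * B := by
          gcongr with m hmr
          rw [integral_mul_const, (hIm m (r - m)).integral_fun_mul_eq_mul_integral
            (hint' i m).aestronglyMeasurable (ih (r - m) (by omega)).1.aestronglyMeasurable,
            abs_mul, abs_mul, Nat.abs_cast]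
          have := (ih (r - m) (by omega)).2
          calc _ ≤ |∫ ω, Y i ω ^ m ∂P| * B * (r.choose m : ℝ) := by gcongr
            _ = _ := by ring
      _ = (∑ m ∈ Finset.range (r + 1), (r.choose m : ℝ) * |∫ ω, Y i ω ^ m ∂P|) * B := by
          rw [Finset.sum_mul]
      _ ≤ _ := by
          gcongr
          refine sum_choose_mul_le (g := fun m => |∫ ω, Y i ω ^ m ∂P|)
            (h := fun m => ∫ ω, |Y i ω| ^ m ∂P) hr (by simp) (by simp [hmean])
            (fun m => abs_nonneg _) fun m => ?_
          simpa [abs_pow] using abs_integral_le_integral_abs (f := fun ω => Y i ω ^ m) (μ := P)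

/-- If `E e^{U_i} ≤ 2` for independent `U_i`, then `E exp (∑_{i ∈ s} U_i) ≤ 2 ^ |s|`. -/
lemma lintegral_exp_sum_le {ι : Type*} [IsProbabilityMeasure P] {U : ι → Ω → ℝ}
    (hind : iIndepFun U P) (hm : ∀ i, Measurable (U i))
    (hint : ∀ i, Integrable (fun ω => Real.exp (U i ω)) P)
    (hle : ∀ i, ∫ ω, Real.exp (U i ω) ∂P ≤ 2) (s : Finset ι) :
    ∫⁻ ω, ENNReal.ofReal (Real.exp (∑ i ∈ s, U i ω)) ∂P ≤ ENNReal.ofReal (2 ^ s.card) := by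
  have h1 := hind.mgf_sum (t := 1) hm s
  have h2 := hind.integrable_exp_mul_sum (t := 1) hm (s := s) fun i _ => by simpa using hint i
  simp only [mgf, one_mul, Finset.sum_apply] at h1 h2
  rw [← ofReal_integral_eq_lintegral_ofReal h2
    (Filter.Eventually.of_forall fun ω => (Real.exp_pos _).le), h1]
  apply ENNReal.ofReal_le_ofReal
  calc ∏ i ∈ s, ∫ ω, Real.exp (U i ω) ∂P ≤ ∏ _i ∈ s, (2 : ℝ) :=
        Finset.prod_le_prod (fun i _ => integral_nonneg fun ω => (Real.exp_pos _).le)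
          fun i _ => hle i
    _ = 2 ^ s.card := by simp

/-! ### The ℓ^β norm and duality -/

lemma vecNorm_conjExp_of_one_lt {n : ℕ} {α : ℝ} (hα : 1 < α) (w : Fin n → ℝ) :
    vecNorm (conjExp α) w = (∑ i, |w i| ^ (α / (α - 1))) ^ (1 / (α / (α - 1))) := by
  have h : 0 < α / (α - 1) := div_pos (by linarith) (by linarith)
  rw [vecNorm, conjExp, if_pos hα, PiLp.norm_eq_sum (by rw [ENNReal.toReal_ofReal h.le]; exact h),
    ENNReal.toReal_ofReal h.le]
  rfl

lemma vecNorm_conjExp_of_le_one {n : ℕ} {α : ℝ} (hα : α ≤ 1) (w : Fin n → ℝ) :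
    vecNorm (conjExp α) w = ⨆ i, |w i| := by
  rw [vecNorm, conjExp, if_neg hα.not_gt, PiLp.norm_eq_ciSup]
  rfl

lemma abs_le_vecNorm_conjExp {n : ℕ} {α : ℝ} (hα : α ≤ 1) (w : Fin n → ℝ) (i : Fin n) :
    |w i| ≤ vecNorm (conjExp α) w := by
  rw [vecNorm_conjExp_of_le_one hα]
  exact le_ciSup (f := fun i => |w i|) (Set.finite_range _).bddAbove i

lemma conjExp_two : conjExp 2 = 2 := by
  rw [conjExp, if_pos (by norm_num)]; norm_num

lemma vecNorm_two_sq {n : ℕ} (w : Fin n → ℝ) : vecNorm 2 w ^ 2 = ∑ i, w i ^ 2 := by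
  rw [vecNorm]
  simpa using EuclideanSpace.real_norm_sq_eq (WithLp.toLp 2 w)

lemma vecNorm_nonneg {n : ℕ} {r : ℝ≥0∞} (hr : 1 ≤ r) (w : Fin n → ℝ) : 0 ≤ vecNorm r w := by
  have : Fact (1 ≤ r) := ⟨hr⟩
  exact norm_nonneg _

lemma one_le_conjExp {α : ℝ} : 1 ≤ conjExp α := by
  unfold conjExp
  split_ifs with h
  · rw [ENNReal.one_le_ofReal, le_div_iff₀ (by linarith)]; linarith
  · exact le_top

/-- Duality between `ℓ^α` and `ℓ^β`, written in terms of `u_i = x_i^α`; for `α ≤ 1` it is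
superadditivity of `x ↦ x^{1/α}`. -/
lemma sum_mul_rpow_le {n : ℕ} {α : ℝ} (hα : 0 < α) (w u : Fin n → ℝ) (hu : ∀ i, 0 ≤ u i)
    (F : Finset (Fin n)) :
    ∑ i ∈ F, |w i| * u i ^ (1 / α) ≤ vecNorm (conjExp α) w * (∑ i ∈ F, u i) ^ (1 / α) := by
  have hS : 0 ≤ ∑ i ∈ F, u i := Finset.sum_nonneg fun i _ => hu i
  rcases le_or_gt α 1 with h1 | h1
  · have hγ : 0 ≤ 1 / α - 1 := by rw [sub_nonneg, le_div_iff₀ hα]; linarith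
    -- With this splitting, superadditivity reduces to monotonicity of x^(1/α - 1), whose exponent
    -- is nonnegative.
    have hsplit : ∀ x : ℝ, 0 ≤ x → x ^ (1 / α) = x * x ^ (1 / α - 1) := by
      intro x hx
      rcases hx.eq_or_lt with rfl | hx
      · rw [Real.zero_rpow (by positivity)]; simp
      · rw [Real.rpow_sub_one hx.ne']; field_simp
    calc ∑ i ∈ F, |w i| * u i ^ (1 / α)
        ≤ ∑ i ∈ F, vecNorm (conjExp α) w * (u i * (∑ i ∈ F, u i) ^ (1 / α - 1)) := by
          refine Finset.sum_le_sum fun i hi => ?_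
          rw [hsplit _ (hu i)]
          have h2 := hu i
          have h3 : u i ≤ ∑ i ∈ F, u i := Finset.single_le_sum (fun i _ => hu i) hi
          have h4 := abs_le_vecNorm_conjExp h1 w i
          gcongr
          exact (abs_nonneg _).trans h4
      _ = _ := by rw [← Finset.mul_sum, ← Finset.sum_mul, ← hsplit _ hS]
  · have hc : (α / (α - 1)).HolderConjugate α := (Real.HolderConjugate.conjExponent h1).symm
    calc ∑ i ∈ F, |w i| * u i ^ (1 / α)
        ≤ (∑ i ∈ F, |w i| ^ (α / (α - 1))) ^ (1 / (α / (α - 1))) *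
          (∑ i ∈ F, (u i ^ (1 / α)) ^ α) ^ (1 / α) :=
          Real.inner_le_Lp_mul_Lq_of_nonneg F hc (fun i _ => abs_nonneg _)
            fun i _ => Real.rpow_nonneg (hu i) _
      _ ≤ _ := by
          rw [vecNorm_conjExp_of_one_lt h1]
          have : ∀ i, (u i ^ (1 / α)) ^ α = u i := fun i => by
            rw [← Real.rpow_mul (hu i), one_div_mul_cancel hα.ne', Real.rpow_one]
          simp_rw [this]
          gcongr
          exact Finset.subset_univ F

/-! ### The head: at most p indices -/

/-- The contribution of at most `p` indices. No centring is needed here. -/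
lemma eLpNorm_sum_le_of_card_le [IsProbabilityMeasure P] {n : ℕ} {α : ℝ} (hα : 0 < α)
    {L a : Fin n → ℝ} (hL : ∀ i, 0 ≤ L i) (ha : ∀ i, 0 ≤ a i) {X : Fin n → Ω → ℝ}
    (hX : MemClass P α L X) {p : ℝ} (hp : 1 ≤ p) {F : Finset (Fin n)} (hF : (F.card : ℝ) ≤ p)
    {v w : Fin n → ℝ} (hv : ∀ i ∈ F, a i ≤ |v i|) (hw : ∀ i ∈ F, a i * L i ≤ |w i|) :
    eLpNorm (fun ω => ∑ i ∈ F, a i * X i ω) (ENNReal.ofReal p) P ≤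
      ENNReal.ofReal (2 * vecNorm 2 v * (2 * (1 / 2 * p) ^ (1 / 2 : ℝ)) +
        2 * vecNorm (conjExp α) w * (2 * (1 / α * p) ^ (1 / α))) := by
  set U : Fin n → Ω → ℝ := fun i ω => phiExp α (L i) (|X i ω| / 2) with hU
  have hU0 : ∀ i ω, 0 ≤ U i ω := fun i ω => phiExp_nonneg (hL i) (by positivity)
  have hUm : ∀ i, Measurable (U i) := fun i =>
    (measurable_phiExp α (L i)).comp ((hX.measurable i).abs.div_const 2)
  have hUi : iIndepFun U P := hX.indep.comp (fun i x => phiExp α (L i) (|x| / 2)) fun i =>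
    (measurable_phiExp α (L i)).comp (by fun_prop)
  set S : Ω → ℝ := fun ω => ∑ i ∈ F, U i ω with hS
  have hS0 : ∀ ω, 0 ≤ S ω := fun ω => Finset.sum_nonneg fun i _ => hU0 i ω
  have hSm : Measurable S := Finset.measurable_sum _ fun i _ => hUm i
  -- Here the cardinality bound enters: 2^|F| ≤ 2^p costs only a factor 2 after the p-th root.
  have hE : ∫⁻ ω, ENNReal.ofReal (Real.exp (S ω)) ∂P ≤ ENNReal.ofReal (2 ^ p) := by
    refine (lintegral_exp_sum_le hUi hUm
      (fun i => (integral_exp_phiExp_le_two hα (hL i) (hX.measurable i) (hX.norm_le_one i)).1)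
      (fun i => (integral_exp_phiExp_le_two hα (hL i) (hX.measurable i) (hX.norm_le_one i)).2)
      F).trans (ENNReal.ofReal_le_ofReal ?_)
    rw [← Real.rpow_natCast]
    exact Real.rpow_le_rpow_of_exponent_le (by norm_num) hF
  have hn2 : 0 ≤ vecNorm 2 v := vecNorm_nonneg (by norm_num) _
  have hnN : 0 ≤ vecNorm (conjExp α) w := vecNorm_nonneg one_le_conjExp _
  have hpt : ∀ ω, ‖∑ i ∈ F, a i * X i ω‖ ≤
      ‖(2 * vecNorm 2 v) • S ω ^ (1 / 2 : ℝ) + (2 * vecNorm (conjExp α) w) • S ω ^ (1 / α)‖ := by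
    intro ω
    have hs := hS0 ω
    have hR : 0 ≤ (2 * vecNorm 2 v) • S ω ^ (1 / 2 : ℝ) +
        (2 * vecNorm (conjExp α) w) • S ω ^ (1 / α) := by
      simp only [smul_eq_mul]; positivity
    rw [Real.norm_of_nonneg hR]
    -- The Gaussian term is the same duality at exponent 2, which is self-conjugate.
    have h1 := sum_mul_rpow_le two_pos v (fun i => U i ω) (fun i => hU0 i ω) F
    rw [conjExp_two] at h1
    have h2 := sum_mul_rpow_le hα w (fun i => U i ω) (fun i => hU0 i ω) F
    calc ‖∑ i ∈ F, a i * X i ω‖ ≤ ∑ i ∈ F, a i * |X i ω| := by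
          refine (norm_sum_le _ _).trans (le_of_eq (Finset.sum_congr rfl fun i _ => ?_))
          rw [norm_mul, Real.norm_of_nonneg (ha i), Real.norm_eq_abs]
      _ ≤ ∑ i ∈ F, (2 * (|v i| * U i ω ^ (1 / 2 : ℝ)) + 2 * (|w i| * U i ω ^ (1 / α))) := by
          refine Finset.sum_le_sum fun i hi => ?_
          have h3 := le_sqrt_phiExp_add hα (hL i) (show 0 ≤ |X i ω| / 2 by positivity)
          have h4 : 0 ≤ U i ω ^ (1 / 2 : ℝ) := Real.rpow_nonneg (hU0 i ω) _
          have h5 : 0 ≤ U i ω ^ (1 / α) := Real.rpow_nonneg (hU0 i ω) _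
          have h6 := mul_le_mul_of_nonneg_right (hv i hi) h4
          have h7 := mul_le_mul_of_nonneg_right (hw i hi) h5
          have h8 := mul_le_mul_of_nonneg_left h3 (ha i)
          simp only [hU] at *
          linarith
      _ ≤ _ := by
          rw [Finset.sum_add_distrib, ← Finset.mul_sum, ← Finset.mul_sum]
          simp only [smul_eq_mul, hS]
          linarith
  have hp' : 1 ≤ ENNReal.ofReal p := by rwa [ENNReal.one_le_ofReal]
  calc eLpNorm (fun ω => ∑ i ∈ F, a i * X i ω) (ENNReal.ofReal p) P
      ≤ eLpNorm ((2 * vecNorm 2 v) • (fun ω => S ω ^ (1 / 2 : ℝ)) +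
          (2 * vecNorm (conjExp α) w) • (fun ω => S ω ^ (1 / α))) (ENNReal.ofReal p) P :=
        eLpNorm_mono hpt
    _ ≤ eLpNorm ((2 * vecNorm 2 v) • (fun ω => S ω ^ (1 / 2 : ℝ))) (ENNReal.ofReal p) P +
          eLpNorm ((2 * vecNorm (conjExp α) w) • (fun ω => S ω ^ (1 / α))) (ENNReal.ofReal p) P :=
        eLpNorm_add_le (by fun_prop) (by fun_prop) hp'
    _ ≤ ENNReal.ofReal (2 * vecNorm 2 v) * ENNReal.ofReal (2 * (1 / 2 * p) ^ (1 / 2 : ℝ)) +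
          ENNReal.ofReal (2 * vecNorm (conjExp α) w) *
            ENNReal.ofReal (2 * (1 / α * p) ^ (1 / α)) := by
        rw [eLpNorm_const_smul, eLpNorm_const_smul, Real.enorm_of_nonneg (by positivity),
          Real.enorm_of_nonneg (by positivity)]
        gcongr
        · exact eLpNorm_rpow_le hS0 (by norm_num) hp (by norm_num) hE
        · exact eLpNorm_rpow_le hS0 (by positivity) hp (by norm_num) hE
    _ = _ := by
        rw [← ENNReal.ofReal_mul (by positivity), ← ENNReal.ofReal_mul (by positivity),
          ← ENNReal.ofReal_add (by positivity) (by positivity)]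

/-! ### The tail: moment series with small coefficients -/

lemma choose_le_exp_mul_div_pow (q : ℕ) {j : ℕ} (hj : 1 ≤ j) :
    (q.choose j : ℝ) ≤ (Real.exp 1 * q / j) ^ j := by
  have hj0 : (0 : ℝ) < j := by exact_mod_cast hj
  have h1 : (j : ℝ) ^ j / (j.factorial : ℝ) ≤ Real.exp j := Real.pow_div_factorial_le_exp _ hj0.le _
  have h2 : (q.choose j : ℝ) ≤ (q : ℝ) ^ j / (j.factorial : ℝ) := Nat.choose_le_pow_div j q
  have hf : (0 : ℝ) < j.factorial := by exact_mod_cast j.factorial_pos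
  calc (q.choose j : ℝ) ≤ (q : ℝ) ^ j / (j.factorial : ℝ) := h2
    _ = (q : ℝ) ^ j / (j : ℝ) ^ j * ((j : ℝ) ^ j / (j.factorial : ℝ)) := by field_simp
    _ ≤ (q : ℝ) ^ j / (j : ℝ) ^ j * Real.exp j := by gcongr
    _ = _ := by
      rw [div_pow, mul_pow, ← Real.exp_nat_mul, mul_one]; ring

lemma sum_half_pow_le (q : ℕ) : ∑ j ∈ Finset.Icc 2 q, (1 / 2 : ℝ) ^ (j - 2) ≤ 2 := by
  have h : ∑ j ∈ Finset.Icc 2 q, (1 / 2 : ℝ) ^ (j - 2) = ∑ k ∈ Finset.range (q - 1), (1 / 2 : ℝ) ^ k := by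
    rw [← Finset.Ico_succ_right_eq_Icc, Finset.sum_Ico_eq_sum_range]
    simp
  rw [h]
  have := sum_geometric_two_le (q - 1)
  simpa using this

/-- The constant in `sum_choose_mul_moment_le`. -/
noncomputable def seriesConst (α : ℝ) : ℝ :=
  4 * (4 * Real.exp 1) ^ 2 + 4 * (2 * max (1 / α - 1) 0) ^ (2 * max (1 / α - 1) 0) *
    (4 * Real.exp 1 ^ 2 * (1 / α) ^ (1 / α)) ^ 2

/-- The j^(-j) from the binomial coefficient absorbs the moment growth (j/2)^(j/2) ≤ j^j, leaving a
pure power of q b. Two factors are kept and the remaining j - 2 are at most 1/2 each. -/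
lemma gaussian_term_le {b : ℝ} (hb : 0 ≤ b) {q j : ℕ} (hj : 2 ≤ j)
    (h : 4 * Real.exp 1 * (q * b) ≤ 1 / 2) :
    (q.choose j : ℝ) * (b ^ j * (4 ^ j * (2 * ((1 / 2 * j : ℝ) ^ (1 / 2 * j : ℝ))))) ≤
      2 * (4 * Real.exp 1) ^ 2 * (q * b) ^ 2 * (1 / 2) ^ (j - 2) := by
  have hj0 : (1 : ℝ) ≤ j := by exact_mod_cast (by omega : 1 ≤ j)
  have h1 : (1 / 2 * j : ℝ) ^ (1 / 2 * j : ℝ) ≤ (j : ℝ) ^ j := by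
    calc (1 / 2 * j : ℝ) ^ (1 / 2 * j : ℝ) ≤ (j : ℝ) ^ (1 / 2 * j : ℝ) := by
          gcongr; linarith
      _ ≤ (j : ℝ) ^ (j : ℝ) := Real.rpow_le_rpow_of_exponent_le hj0 (by linarith)
      _ = (j : ℝ) ^ j := Real.rpow_natCast _ _
  calc (q.choose j : ℝ) * (b ^ j * (4 ^ j * (2 * ((1 / 2 * j : ℝ) ^ (1 / 2 * j : ℝ)))))
      ≤ (Real.exp 1 * q / j) ^ j * (b ^ j * (4 ^ j * (2 * (j : ℝ) ^ j))) := by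
        gcongr
        exact choose_le_exp_mul_div_pow q (by omega)
    _ = 2 * (4 * Real.exp 1 * (q * b)) ^ j := by
        have : (Real.exp 1 * q / j * b * 4 * j) = 4 * Real.exp 1 * (q * b) := by field_simp
        rw [← this]; simp only [mul_pow]; ring
    _ = 2 * ((4 * Real.exp 1 * (q * b)) ^ 2 * (4 * Real.exp 1 * (q * b)) ^ (j - 2)) := by
        rw [← pow_add]; congr 3; omega
    _ ≤ 2 * ((4 * Real.exp 1 * (q * b)) ^ 2 * (1 / 2) ^ (j - 2)) := by gcongr
    _ = _ := by ring

/-- The moments grow like j^(j/α), so after cancelling j^(-j) an excess j^(gj), g = max(1/α - 1, 0),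
can remain. Two of its factors j^g are absorbed in e^j at constant cost. The other j - 2 are bounded
by q^g, and the hypothesis makes each resulting ratio at most 1/2. -/
lemma weibull_term_le {α L b : ℝ} (hα : 0 < α) (hL : 0 ≤ L) (hb : 0 ≤ b) {q j : ℕ} (hj : 2 ≤ j)
    (hjq : j ≤ q)
    (h : 4 * Real.exp 1 ^ 2 * (1 / α) ^ (1 / α) * (q * (b * L)) *
      (q : ℝ) ^ (max (1 / α - 1) 0) ≤ 1 / 2) :
    (q.choose j : ℝ) * (b ^ j * (4 ^ j * (2 * (L ^ j * (1 / α * j : ℝ) ^ (1 / α * j : ℝ))))) ≤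
      2 * (2 * max (1 / α - 1) 0) ^ (2 * max (1 / α - 1) 0) *
        (4 * Real.exp 1 ^ 2 * (1 / α) ^ (1 / α)) ^ 2 * (q * (b * L)) ^ 2 * (1 / 2) ^ (j - 2) := by
  set g := max (1 / α - 1) 0 with hg
  have hg0 : 0 ≤ g := le_max_right _ _
  have hj1 : (1 : ℝ) ≤ j := by exact_mod_cast (by omega : 1 ≤ j)
  have hj0 : (0 : ℝ) < j := by linarith
  have hjq' : (j : ℝ) ≤ q := by exact_mod_cast hjq
  set κ : ℝ := (1 / α) ^ (1 / α) with hκ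
  have hκ0 : 0 ≤ κ := by positivity
  have h1 : (1 / α * j : ℝ) ^ (1 / α * j : ℝ) ≤ (κ * (j * (j : ℝ) ^ g)) ^ j := by
    rw [Real.rpow_mul (by positivity), Real.rpow_natCast]
    gcongr
    rw [Real.mul_rpow (by positivity) hj0.le]
    gcongr
    calc (j : ℝ) ^ (1 / α) = j * (j : ℝ) ^ (1 / α - 1) := by
          rw [Real.rpow_sub_one hj0.ne']; field_simp
      _ ≤ _ := by
        gcongr
        exact le_max_left _ _
  have h2 : ((j : ℝ) ^ g) ^ j ≤ (2 * g) ^ (2 * g) * Real.exp 1 ^ j * ((q : ℝ) ^ g) ^ (j - 2) := by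
    calc ((j : ℝ) ^ g) ^ j = ((j : ℝ) ^ g) ^ 2 * ((j : ℝ) ^ g) ^ (j - 2) := by
          rw [← pow_add]; congr 1; omega
      _ ≤ ((2 * g) ^ (2 * g) * Real.exp 1 ^ j) * ((q : ℝ) ^ g) ^ (j - 2) := by
          gcongr
          have := rpow_le_rpow_self_mul_exp (s := 2 * g) (by positivity) hj0.le
          rwa [← Real.exp_nat_mul, mul_one, ← Real.rpow_two, ← Real.rpow_mul hj0.le, mul_comm g]
  set K3 : ℝ := (2 * g) ^ (2 * g)
  have hK3 : 0 ≤ K3 := by positivity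
  set z : ℝ := 4 * Real.exp 1 ^ 2 * κ * (q * (b * L)) with hz
  have hz0 : 0 ≤ z := by positivity
  calc (q.choose j : ℝ) * (b ^ j * (4 ^ j * (2 * (L ^ j * (1 / α * j : ℝ) ^ (1 / α * j : ℝ)))))
      ≤ (Real.exp 1 * q / j) ^ j *
          (b ^ j * (4 ^ j * (2 * (L ^ j * (κ * (j * (j : ℝ) ^ g)) ^ j)))) := by
        gcongr
        exact choose_le_exp_mul_div_pow q (by omega)
    _ = 2 * (4 * Real.exp 1 * κ * (q * (b * L))) ^ j * ((j : ℝ) ^ g) ^ j := by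
        have : (Real.exp 1 * q / j * b * 4 * L * κ * j) =
          4 * Real.exp 1 * κ * (q * (b * L)) := by field_simp
        rw [← this]; simp only [mul_pow]; ring
    _ ≤ 2 * (4 * Real.exp 1 * κ * (q * (b * L))) ^ j *
          (K3 * Real.exp 1 ^ j * ((q : ℝ) ^ g) ^ (j - 2)) := by gcongr
    _ = 2 * K3 * z ^ j * ((q : ℝ) ^ g) ^ (j - 2) := by
        have : z = 4 * Real.exp 1 * κ * (q * (b * L)) * Real.exp 1 := by rw [hz]; ring
        rw [this, mul_pow _ (Real.exp 1)]; ring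
    _ = 2 * K3 * z ^ 2 * (z * (q : ℝ) ^ g) ^ (j - 2) := by
        rw [mul_pow z]
        have : z ^ j = z ^ 2 * z ^ (j - 2) := by rw [← pow_add]; congr 1; omega
        rw [this]; ring
    _ ≤ 2 * K3 * z ^ 2 * (1 / 2) ^ (j - 2) := by gcongr
    _ = _ := by rw [hz]; ring

/-- The bound is quadratic in b max(1, L), so summing over the variables produces the ℓ² norm of a ⊙
L̄. -/
lemma sum_choose_mul_moment_le {α L b : ℝ} (hα : 0 < α) (hL : 0 ≤ L) (hb : 0 ≤ b) {q : ℕ}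
    (h1 : 4 * Real.exp 1 * (q * b) ≤ 1 / 2)
    (h2 : 4 * Real.exp 1 ^ 2 * (1 / α) ^ (1 / α) * (q * (b * L)) *
      (q : ℝ) ^ (max (1 / α - 1) 0) ≤ 1 / 2) :
    ∑ j ∈ Finset.Icc 2 q, (q.choose j : ℝ) * (b ^ j * (4 ^ j *
      (2 * ((1 / 2 * j : ℝ) ^ (1 / 2 * j : ℝ) + L ^ j * (1 / α * j : ℝ) ^ (1 / α * j : ℝ))))) ≤
      seriesConst α * (q * (b * max 1 L)) ^ 2 := by
  have hb1 : b ≤ b * max 1 L := le_mul_of_one_le_right hb (le_max_left _ _)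
  have hb2 : b * L ≤ b * max 1 L := by gcongr; exact le_max_right _ _
  have hg0 : 0 ≤ max (1 / α - 1) 0 := le_max_right _ _
  set K1 : ℝ := (4 * Real.exp 1) ^ 2 with hK1
  set K2 : ℝ := (2 * max (1 / α - 1) 0) ^ (2 * max (1 / α - 1) 0) *
    (4 * Real.exp 1 ^ 2 * (1 / α) ^ (1 / α)) ^ 2 with hK2
  have hK1' : 0 ≤ K1 := by positivity
  have hK2' : 0 ≤ K2 := by positivity
  calc _ ≤ ∑ j ∈ Finset.Icc 2 q, (2 * (K1 + K2) * (q * (b * max 1 L)) ^ 2) * (1 / 2) ^ (j - 2) := by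
        refine Finset.sum_le_sum fun j hj => ?_
        rw [Finset.mem_Icc] at hj
        have e1 := gaussian_term_le hb hj.1 h1
        have e2 := weibull_term_le hα hL hb hj.1 hj.2 h2
        calc _ = _ := by
              rw [mul_add 2, mul_add (4 ^ j), mul_add (b ^ j), mul_add (q.choose j : ℝ)]
          _ ≤ _ := add_le_add e1 e2
          _ ≤ 2 * K1 * (q * (b * max 1 L)) ^ 2 * (1 / 2) ^ (j - 2) +
                2 * K2 * (q * (b * max 1 L)) ^ 2 * (1 / 2) ^ (j - 2) := by
              rw [hK2, ← mul_assoc 2]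
              gcongr
          _ = _ := by ring
    _ = (2 * (K1 + K2) * (q * (b * max 1 L)) ^ 2) * ∑ j ∈ Finset.Icc 2 q, (1 / 2) ^ (j - 2) := by
        rw [Finset.mul_sum]
    _ ≤ (2 * (K1 + K2) * (q * (b * max 1 L)) ^ 2) * 2 := by
        gcongr; exact sum_half_pow_le q
    _ = _ := by rw [seriesConst, hK1, hK2]; ring

/-- One factor 2^j undoes the halving of |x|; the other comes from (u + v)^j ≤ 2^(j-1) (u^j + v^j).
-/
lemma abs_pow_le_mul_exp_phiExp {α L : ℝ} (hα : 0 < α) (hL : 0 ≤ L) (x : ℝ) (j : ℕ) :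
    |x| ^ j ≤ 4 ^ j * ((1 / 2 * j : ℝ) ^ (1 / 2 * j : ℝ) + L ^ j * (1 / α * j : ℝ) ^ (1 / α * j : ℝ)) *
      Real.exp (phiExp α L (|x| / 2)) := by
  set U := phiExp α L (|x| / 2) with hU
  have hU0 : 0 ≤ U := phiExp_nonneg hL (by positivity)
  have h := le_sqrt_phiExp_add hα hL (show 0 ≤ |x| / 2 by positivity)
  rw [← hU] at h
  have hpow : ∀ s : ℝ, 0 ≤ s → (U ^ s) ^ j ≤ (s * j) ^ (s * j) * Real.exp U := fun s hs => by
    rw [← Real.rpow_natCast, ← Real.rpow_mul hU0]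
    exact rpow_le_rpow_self_mul_exp (by positivity) hU0
  calc |x| ^ j = 2 ^ j * (|x| / 2) ^ j := by rw [← mul_pow]; congr 1; ring
    _ ≤ 2 ^ j * (U ^ (1 / 2 : ℝ) + L * U ^ (1 / α)) ^ j := by gcongr
    _ ≤ 2 ^ j * (2 ^ j * ((U ^ (1 / 2 : ℝ)) ^ j + (L * U ^ (1 / α)) ^ j)) := by
        gcongr
        refine (add_pow_le (by positivity) (by positivity) j).trans ?_
        gcongr
        · norm_num
        · omega
    _ ≤ 2 ^ j * (2 ^ j * ((1 / 2 * j : ℝ) ^ (1 / 2 * j : ℝ) * Real.exp U +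
          L ^ j * ((1 / α * j : ℝ) ^ (1 / α * j : ℝ) * Real.exp U))) := by
        rw [mul_pow]
        gcongr
        · exact hpow _ (by norm_num)
        · exact hpow _ (by positivity)
    _ = _ := by
        rw [show (4 : ℝ) = 2 * 2 by norm_num, mul_pow]; ring

lemma integral_abs_pow_le [IsProbabilityMeasure P] {α L : ℝ} (hα : 0 < α) (hL : 0 ≤ L)
    {X : Ω → ℝ} (hX : Measurable X) (h : orliczNorm (phi α L) X P ≤ 1) (j : ℕ) :
    Integrable (fun ω => |X ω| ^ j) P ∧ ∫ ω, |X ω| ^ j ∂P ≤ 4 ^ j *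
      (2 * ((1 / 2 * j : ℝ) ^ (1 / 2 * j : ℝ) + L ^ j * (1 / α * j : ℝ) ^ (1 / α * j : ℝ))) := by
  obtain ⟨hi, hle⟩ := integral_exp_phiExp_le_two hα hL hX h
  set c : ℝ := 4 ^ j *
    ((1 / 2 * j : ℝ) ^ (1 / 2 * j : ℝ) + L ^ j * (1 / α * j : ℝ) ^ (1 / α * j : ℝ)) with hc
  have hc0 : 0 ≤ c := by positivity
  have hI : Integrable (fun ω => |X ω| ^ j) P := by
    refine (hi.const_mul c).mono (by fun_prop) (Filter.Eventually.of_forall fun ω => ?_)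
    rw [Real.norm_of_nonneg (by positivity), Real.norm_of_nonneg (by positivity)]
    exact abs_pow_le_mul_exp_phiExp hα hL (X ω) j
  refine ⟨hI, ?_⟩
  calc ∫ ω, |X ω| ^ j ∂P ≤ ∫ ω, c * Real.exp (phiExp α L (|X ω| / 2)) ∂P :=
        integral_mono hI (hi.const_mul c) fun ω => abs_pow_le_mul_exp_phiExp hα hL (X ω) j
    _ = c * ∫ ω, Real.exp (phiExp α L (|X ω| / 2)) ∂P := integral_const_mul _ _
    _ ≤ c * 2 := by gcongr
    _ = _ := by rw [hc]; ring

lemma eLpNorm_natCast_le_of_integral_pow_le {f : Ω → ℝ} {q : ℕ} (hq : Even q) (hq0 : q ≠ 0)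
    (hf : Integrable (fun ω => f ω ^ q) P) {K : ℝ} (hK : 0 ≤ K) (h : ∫ ω, f ω ^ q ∂P ≤ K ^ q) :
    eLpNorm f q P ≤ ENNReal.ofReal K := by
  have hq' : (0 : ℝ) < q := by exact_mod_cast Nat.pos_of_ne_zero hq0
  rw [eLpNorm_eq_lintegral_rpow_enorm_toReal (by simpa using hq0) (by simp), ENNReal.toReal_natCast]
  have h1 : ∫⁻ ω, ‖f ω‖ₑ ^ (q : ℝ) ∂P = ENNReal.ofReal (∫ ω, f ω ^ q ∂P) := by
    rw [ofReal_integral_eq_lintegral_ofReal hf (Filter.Eventually.of_forall fun ω => hq.pow_nonneg _)]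
    refine lintegral_congr fun ω => ?_
    rw [Real.enorm_eq_ofReal_abs, ENNReal.rpow_natCast, ← ENNReal.ofReal_pow (abs_nonneg _),
      hq.pow_abs]
  rw [h1]
  calc _ ≤ (ENNReal.ofReal (K ^ q)) ^ (1 / (q : ℝ)) := by gcongr
    _ = ENNReal.ofReal K := by
      rw [ENNReal.ofReal_rpow_of_nonneg (by positivity) (by positivity), ← Real.rpow_natCast,
        ← Real.rpow_mul hK, mul_one_div_cancel hq'.ne', Real.rpow_one]

lemma seriesConst_nonneg (α : ℝ) : 0 ≤ seriesConst α := by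
  have : 0 ≤ max (1 / α - 1) 0 := le_max_right _ _
  unfold seriesConst
  positivity

/-- The contribution of indices whose coefficients are small on the scale `t / q`. -/
lemma eLpNorm_sum_le_of_coeff_small [IsProbabilityMeasure P] {n : ℕ} {α : ℝ} (hα : 0 < α)
    {L a : Fin n → ℝ} (hL : ∀ i, 0 ≤ L i) (ha : ∀ i, 0 ≤ a i) {X : Fin n → Ω → ℝ}
    (hX : MemClass P α L X) {q : ℕ} (hq : Even q) (hq0 : q ≠ 0) {t R : ℝ} (ht : 0 < t)
    {G : Finset (Fin n)}
    (h1 : ∀ i ∈ G, 4 * Real.exp 1 * (q * (a i / t)) ≤ 1 / 2)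
    (h2 : ∀ i ∈ G, 4 * Real.exp 1 ^ 2 * (1 / α) ^ (1 / α) * (q * (a i / t * L i)) *
      (q : ℝ) ^ (max (1 / α - 1) 0) ≤ 1 / 2)
    (hR : ∑ i ∈ G, (q * (a i / t * max 1 (L i))) ^ 2 ≤ R * q) :
    eLpNorm (fun ω => ∑ i ∈ G, a i * X i ω) q P ≤
      ENNReal.ofReal (t * Real.exp (seriesConst α * R)) := by
  have hY := abs_integral_sum_pow_le (P := P) (Y := fun i ω => a i / t * X i ω)
    (hX.indep.comp (fun i x => a i / t * x) fun i => by fun_prop)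
    (fun i => (hX.measurable i).const_mul _)
    (fun i j => by
      simp_rw [abs_mul, mul_pow]
      exact (integral_abs_pow_le hα (hL i) (hX.measurable i) (hX.norm_le_one i) j).1.const_mul _)
    (fun i => by rw [integral_const_mul, hX.mean_zero, mul_zero]) q G q le_rfl
  have hprod : ∏ i ∈ G, (1 + ∑ j ∈ Finset.Icc 2 q, (q.choose j : ℝ) *
      ∫ ω, |a i / t * X i ω| ^ j ∂P) ≤ Real.exp (seriesConst α * R) ^ q := by
    have hsum0 : ∀ i, 0 ≤ ∑ j ∈ Finset.Icc 2 q, (q.choose j : ℝ) *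
        ∫ ω, |a i / t * X i ω| ^ j ∂P := fun i => Finset.sum_nonneg fun j _ =>
      mul_nonneg (by positivity) (integral_nonneg fun ω => by positivity)
    -- The inequality 1 + x ≤ exp(x) turns the product into the exponential of a sum of squares.
    calc _ ≤ ∏ i ∈ G, Real.exp (seriesConst α * (q * (a i / t * max 1 (L i))) ^ 2) := by
          refine Finset.prod_le_prod (fun i _ => by have := hsum0 i; linarith) fun i hi => ?_
          rw [add_comm]
          refine (Real.add_one_le_exp _).trans (Real.exp_le_exp.mpr ?_)
          have hb : 0 ≤ a i / t := div_nonneg (ha i) ht.le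
          refine le_trans ?_ (sum_choose_mul_moment_le hα (hL i) hb (h1 i hi) (h2 i hi))
          refine Finset.sum_le_sum fun j _ => ?_
          simp_rw [abs_mul, mul_pow, integral_const_mul, abs_of_nonneg hb]
          gcongr
          exact (integral_abs_pow_le hα (hL i) (hX.measurable i) (hX.norm_le_one i) j).2
      _ = Real.exp (seriesConst α * ∑ i ∈ G, (q * (a i / t * max 1 (L i))) ^ 2) := by
          rw [← Real.exp_sum, Finset.mul_sum]
      _ ≤ Real.exp (seriesConst α * (R * q)) := by
          gcongr
          exact seriesConst_nonneg α
      _ = _ := by rw [← Real.exp_nat_mul]; congr 1; ring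
  have hnorm := eLpNorm_natCast_le_of_integral_pow_le hq hq0 hY.1 (Real.exp_pos _).le
    ((le_abs_self _).trans (hY.2.trans hprod))
  have heq : (fun ω => ∑ i ∈ G, a i * X i ω) = t • fun ω => ∑ i ∈ G, a i / t * X i ω := by
    ext ω
    simp only [Pi.smul_apply, smul_eq_mul, Finset.mul_sum]
    refine Finset.sum_congr rfl fun i _ => ?_
    field_simp
  rw [heq, eLpNorm_const_smul, Real.enorm_of_nonneg ht.le, ENNReal.ofReal_mul ht.le]
  gcongr

/-! ### The upper bound -/

lemma one_le_Lbar {n : ℕ} (L : Fin n → ℝ) (i : Fin n) : 1 ≤ Lbar L i := le_max_left _ _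

lemma card_filter_add_one_le {n : ℕ} {p : ℝ} (hp : 0 ≤ p) :
    ((Finset.univ.filter fun i : Fin n => ((i : ℕ) : ℝ) + 1 ≤ p).card : ℝ) ≤ p := by
  refine le_trans ?_ (Nat.floor_le hp)
  norm_cast
  rw [← Finset.card_map Fin.valEmbedding, ← Finset.card_range ⌊p⌋₊]
  refine Finset.card_le_card fun k hk => ?_
  simp only [Finset.mem_map, Finset.mem_filter, Finset.mem_univ, true_and] at hk
  obtain ⟨i, hi, rfl⟩ := hk
  rw [Finset.mem_range]
  apply Nat.lt_of_succ_le
  rw [Nat.le_floor_iff hp]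
  simpa using hi

/-- The i + 1 entries up to position i (counted from 0) are all at least A i, and i + 1 ≥ p. -/
lemma sqrt_mul_le_vecNorm_of_antitone {n : ℕ} {A : Fin n → ℝ} (hA0 : ∀ i, 0 ≤ A i)
    (hA : Antitone A) {p : ℝ} {i : Fin n} (hi : p ≤ ((i : ℕ) : ℝ) + 1) :
    Real.sqrt p * A i ≤ vecNorm 2 A := by
  have hn : 0 ≤ vecNorm 2 A := vecNorm_nonneg (by norm_num) _
  refine le_of_sq_le_sq ?_ hn
  rw [mul_pow, vecNorm_two_sq]
  calc Real.sqrt p ^ 2 * A i ^ 2 ≤ (((i : ℕ) : ℝ) + 1) * A i ^ 2 := by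
        gcongr
        rcases le_total 0 p with h | h
        · rwa [Real.sq_sqrt h]
        · rw [Real.sqrt_eq_zero_of_nonpos h]
          have : (0 : ℝ) ≤ ((i : ℕ) : ℝ) := Nat.cast_nonneg _
          linarith
    _ = ∑ _j ∈ Finset.Iic i, A i ^ 2 := by
        rw [Finset.sum_const, Fin.card_Iic]; simp
    _ ≤ ∑ j ∈ Finset.Iic i, A j ^ 2 := by
        refine Finset.sum_le_sum fun j hj => ?_
        have := hA0 i
        gcongr
        exact hA (Finset.mem_Iic.mp hj)
    _ ≤ ∑ j, A j ^ 2 :=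
        Finset.sum_le_sum_of_subset_of_nonneg (Finset.subset_univ _) fun _ _ _ => sq_nonneg _

lemma momentBound_nonneg {n : ℕ} {α : ℝ} {L a : Fin n → ℝ} {p : ℝ} :
    0 ≤ momentBound α L a p :=
  le_max_of_le_left (mul_nonneg (Real.sqrt_nonneg _) (vecNorm_nonneg (by norm_num) _))

/-- Smallness for the Weibull terms. For α ≤ 1 the extra power of q is paid by p^(1/α) times the sup
norm, which therefore has to run over all indices and not only the first p. For α > 1 the extra
exponent is 0 and the bound on q a_i L̄_i suffices. -/
lemma nat_mul_rpow_max_le {n : ℕ} {α : ℝ} (hα : 0 < α) {L a : Fin n → ℝ} (hL : ∀ i, 0 ≤ L i)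
    (ha : ∀ i, 0 ≤ a i) {p : ℝ} (hp : 1 ≤ p) {q : ℕ} (hq0 : q ≠ 0) (hq : (q : ℝ) ≤ 4 * p)
    {i : Fin n} (hqA : q * (a i * Lbar L i) ≤ 4 * momentBound α L a p) :
    q * (a i * L i) * (q : ℝ) ^ (max (1 / α - 1) 0) ≤
      (4 ^ (1 / α) + 4) * momentBound α L a p := by
  have hM : 0 ≤ momentBound α L a p := momentBound_nonneg
  have hq' : (0 : ℝ) < q := by exact_mod_cast Nat.pos_of_ne_zero hq0
  have haL : 0 ≤ a i * L i := mul_nonneg (ha i) (hL i)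
  have h4 : (0 : ℝ) ≤ 4 ^ (1 / α) := by positivity
  rcases le_or_gt α 1 with h1 | h1
  · have hγ : 0 ≤ 1 / α - 1 := by rw [sub_nonneg, le_div_iff₀ hα]; linarith
    rw [max_eq_left hγ]
    have hN : a i * L i ≤ vecNorm (conjExp α) (heavyPart α L a p) := by
      have := abs_le_vecNorm_conjExp h1 (heavyPart α L a p) i
      rwa [heavyPart, if_pos (Or.inl h1), abs_of_nonneg haL] at this
    calc q * (a i * L i) * (q : ℝ) ^ (1 / α - 1) = (q : ℝ) ^ (1 / α) * (a i * L i) := by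
          rw [Real.rpow_sub_one hq'.ne']; field_simp
      _ ≤ (4 * p) ^ (1 / α) * vecNorm (conjExp α) (heavyPart α L a p) := by gcongr
      _ = 4 ^ (1 / α) * (p ^ (1 / α) * vecNorm (conjExp α) (heavyPart α L a p)) := by
          rw [Real.mul_rpow (by norm_num) (by linarith)]; ring
      _ ≤ 4 ^ (1 / α) * momentBound α L a p := by gcongr; exact le_max_right _ _
      _ ≤ _ := by nlinarith
  · have hγ : 1 / α - 1 ≤ 0 := by rw [sub_nonpos, div_le_iff₀ hα]; linarith
    rw [max_eq_right hγ, Real.rpow_zero, mul_one]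
    have : q * (a i * L i) ≤ q * (a i * Lbar L i) := by
      have := ha i
      gcongr
      exact le_max_right _ _
    nlinarith

lemma eLpNorm_tail_le {Ω : Type u} [MeasurableSpace Ω] {P : Measure Ω} [IsProbabilityMeasure P]
    {n : ℕ} {α : ℝ} (hα : 0 < α) {L a : Fin n → ℝ} (hL : ∀ i, 0 ≤ L i) (ha : ∀ i, 0 ≤ a i)
    (hA : Antitone fun i => a i * Lbar L i) {X : Fin n → Ω → ℝ} (hX : MemClass P α L X) {p : ℝ}
    (hp : 1 ≤ p) (hM : 0 < momentBound α L a p) {T : ℝ} (hT1 : 1 ≤ T)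
    (hT2 : 32 * Real.exp 1 ≤ T)
    (hT3 : 8 * Real.exp 1 ^ 2 * (1 / α) ^ (1 / α) * (4 ^ (1 / α) + 4) ≤ T)
    {G : Finset (Fin n)} (hG : ∀ i ∈ G, p ≤ ((i : ℕ) : ℝ) + 1) :
    eLpNorm (fun ω => ∑ i ∈ G, a i * X i ω) (ENNReal.ofReal p) P ≤
      ENNReal.ofReal (T * Real.exp (seriesConst α * 4) * momentBound α L a p) := by
  set M := momentBound α L a p with hMdef
  set D := vecNorm 2 (fun i => a i * Lbar L i) with hD
  have hD0 : 0 ≤ D := vecNorm_nonneg (by norm_num) _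
  have hA0 : ∀ i, 0 ≤ a i * Lbar L i := fun i =>
    mul_nonneg (ha i) (zero_le_one.trans (one_le_Lbar L i))
  have hDM : Real.sqrt p * D ≤ M := le_max_left _ _
  -- An even exponent with p ≤ q ≤ 4p; the upper estimate uses p ≥ 1.
  set q : ℕ := 2 * ⌈p⌉₊ with hqdef
  have hpq : p ≤ q := by
    have := Nat.le_ceil p
    push_cast [hqdef]; linarith
  have hq4 : (q : ℝ) ≤ 4 * p := by
    have := Nat.ceil_lt_add_one (show 0 ≤ p by linarith)
    push_cast [hqdef]; linarith
  have hq0 : q ≠ 0 := by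
    rintro h
    rw [h] at hpq
    norm_num at hpq; linarith
  have hqA : ∀ i ∈ G, q * (a i * Lbar L i) ≤ 4 * M := by
    intro i hi
    have h1 := sqrt_mul_le_vecNorm_of_antitone hA0 hA (hG i hi)
    calc q * (a i * Lbar L i) ≤ 4 * p * (a i * Lbar L i) := by
          have := hA0 i
          gcongr
      _ = 4 * (Real.sqrt p * (Real.sqrt p * (a i * Lbar L i))) := by
          rw [← mul_assoc (Real.sqrt p), Real.mul_self_sqrt (by linarith)]; ring
      _ ≤ 4 * (Real.sqrt p * D) := by gcongr
      _ ≤ 4 * M := by gcongr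
  have hT0 : 0 < T := by linarith
  have ht : 0 < T * M := by positivity
  have hκ : (0 : ℝ) ≤ (1 / α) ^ (1 / α) := by positivity
  -- The scale is t = T M: T makes both geometric ratios at most 1/2, and R = 4 comes from q ‖a ⊙
  -- L̄‖₂² ≤ 4 M².
  have key := eLpNorm_sum_le_of_coeff_small hα hL ha hX (q := q) ⟨⌈p⌉₊, by omega⟩ hq0 ht (R := 4)
    (G := G) ?_ ?_ ?_
  · calc _ ≤ eLpNorm (fun ω => ∑ i ∈ G, a i * X i ω) q P := by
          refine eLpNorm_le_eLpNorm_of_exponent_le ?_ ?_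
          · rw [← ENNReal.ofReal_natCast]
            exact ENNReal.ofReal_le_ofReal hpq
          · exact (Finset.measurable_sum _ fun i _ =>
              (hX.measurable i).const_mul _).aestronglyMeasurable
      _ ≤ _ := key
      _ = _ := by congr 1; ring
  · intro i hi
    have h1 : a i ≤ a i * Lbar L i := le_mul_of_one_le_right (ha i) (one_le_Lbar L i)
    have h2 : q * a i ≤ 4 * M := le_trans (by gcongr) (hqA i hi)
    calc 4 * Real.exp 1 * (q * (a i / (T * M))) = 4 * Real.exp 1 * (q * a i) / (T * M) := by ring
      _ ≤ 4 * Real.exp 1 * (4 * M) / (T * M) := by gcongr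
      _ = 16 * Real.exp 1 / T := by field_simp; norm_num
      _ ≤ 1 / 2 := by rw [div_le_iff₀ hT0]; linarith
  · intro i hi
    have h2 := nat_mul_rpow_max_le hα hL ha hp hq0 hq4 (hqA i hi)
    calc 4 * Real.exp 1 ^ 2 * (1 / α) ^ (1 / α) * (q * (a i / (T * M) * L i)) *
          (q : ℝ) ^ (max (1 / α - 1) 0)
        = 4 * Real.exp 1 ^ 2 * (1 / α) ^ (1 / α) *
          (q * (a i * L i) * (q : ℝ) ^ (max (1 / α - 1) 0)) / (T * M) := by ring
      _ ≤ 4 * Real.exp 1 ^ 2 * (1 / α) ^ (1 / α) * ((4 ^ (1 / α) + 4) * M) / (T * M) := by gcongr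
      _ = 4 * Real.exp 1 ^ 2 * (1 / α) ^ (1 / α) * (4 ^ (1 / α) + 4) / T := by field_simp
      _ ≤ 1 / 2 := by rw [div_le_iff₀ hT0]; linarith
  · calc ∑ i ∈ G, (q * (a i / (T * M) * max 1 (L i))) ^ 2
        ≤ ∑ i, (q * (a i / (T * M) * max 1 (L i))) ^ 2 :=
          Finset.sum_le_sum_of_subset_of_nonneg (Finset.subset_univ _) fun _ _ _ => sq_nonneg _
      _ = q ^ 2 / (T * M) ^ 2 * D ^ 2 := by
          rw [hD, vecNorm_two_sq, Finset.mul_sum]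
          refine Finset.sum_congr rfl fun i _ => ?_
          rw [Lbar]; ring
      _ = q * (q * D ^ 2) / (T * M) ^ 2 := by ring
      _ ≤ q * (4 * M ^ 2) / (T * M) ^ 2 := by
          refine div_le_div_of_nonneg_right (mul_le_mul_of_nonneg_left ?_ (by positivity))
            (by positivity)
          calc q * D ^ 2 ≤ 4 * p * D ^ 2 := by gcongr
            _ = 4 * (Real.sqrt p * D) ^ 2 := by
              rw [mul_pow, Real.sq_sqrt (by linarith)]; ring
            _ ≤ 4 * M ^ 2 := by gcongr
      _ = 4 * q / T ^ 2 := by field_simp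
      _ ≤ 4 * q := div_le_self (by positivity) (one_le_pow₀ hT1)

/-- The constant in the upper bound. -/
noncomputable def upperConst (α : ℝ) : ℝ :=
  4 + 4 * (1 / α) ^ (1 / α) +
    (1 + 32 * Real.exp 1 + 8 * Real.exp 1 ^ 2 * (1 / α) ^ (1 / α) * (4 ^ (1 / α) + 4)) *
      Real.exp (seriesConst α * 4)

lemma eLpNorm_sum_le_momentBound {Ω : Type u} [MeasurableSpace Ω] {P : Measure Ω}
    [IsProbabilityMeasure P] {n : ℕ} {α : ℝ} (hα : 0 < α) {L a : Fin n → ℝ} (hL : ∀ i, 0 ≤ L i)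
    (ha : ∀ i, 0 ≤ a i) (hA : Antitone fun i => a i * Lbar L i) {X : Fin n → Ω → ℝ}
    (hX : MemClass P α L X) {p : ℝ} (hp : 1 ≤ p) :
    eLpNorm (fun ω => ∑ i, a i * X i ω) (ENNReal.ofReal p) P ≤
      ENNReal.ofReal (upperConst α * momentBound α L a p) := by
  set M := momentBound α L a p with hMdef
  set D := vecNorm 2 (fun i => a i * Lbar L i) with hD
  set N := vecNorm (conjExp α) (heavyPart α L a p) with hN
  have hD0 : 0 ≤ D := vecNorm_nonneg (by norm_num) _
  have hN0 : 0 ≤ N := vecNorm_nonneg one_le_conjExp _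
  have hp0 : 0 < p := by linarith
  have hDM : Real.sqrt p * D ≤ M := le_max_left _ _
  have hNM : p ^ (1 / α) * N ≤ M := le_max_right _ _
  have hκ : (0 : ℝ) ≤ (1 / α) ^ (1 / α) := by positivity
  have hA0 : ∀ i, 0 ≤ a i * Lbar L i := fun i =>
    mul_nonneg (ha i) (zero_le_one.trans (one_le_Lbar L i))
  -- The tail estimate divides by M, so M = 0 is separate; then every a_i vanishes because L̄_i ≥ 1.
  rcases (momentBound_nonneg : 0 ≤ momentBound α L a p).eq_or_lt with hM | hM
  · have hDz : D = 0 := by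
      have h1 : Real.sqrt p * D ≤ 0 := by rw [hM]; exact hDM
      have h2 : 0 < Real.sqrt p := Real.sqrt_pos.mpr hp0
      exact le_antisymm (by nlinarith) hD0
    have haz : ∀ i, a i = 0 := by
      intro i
      have h1 := vecNorm_two_sq (fun i => a i * Lbar L i)
      rw [← hD, hDz] at h1
      have h2 := (Finset.sum_eq_zero_iff_of_nonneg fun i _ => sq_nonneg _).mp
        (h1.symm.trans (by norm_num)) i (Finset.mem_univ i)
      have h3 : a i ≤ a i * Lbar L i := le_mul_of_one_le_right (ha i) (one_le_Lbar L i)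
      have h4 : a i * Lbar L i = 0 := by simpa using h2
      exact le_antisymm (by linarith) (ha i)
    simp [haz]
  · set F := Finset.univ.filter fun i : Fin n => ((i : ℕ) : ℝ) + 1 ≤ p with hF
    have hF1 : ∀ i ∈ F, ((i : ℕ) : ℝ) + 1 ≤ p := fun i hi => (Finset.mem_filter.mp hi).2
    have hhead := eLpNorm_sum_le_of_card_le hα hL ha hX hp (F := F)
      (card_filter_add_one_le hp0.le) (v := fun i => a i * Lbar L i) (w := heavyPart α L a p)
      (fun i _ => by
        rw [abs_of_nonneg (hA0 i)]
        exact le_mul_of_one_le_right (ha i) (one_le_Lbar L i))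
      (fun i hi => by
        rw [heavyPart, if_pos (Or.inr (hF1 i hi))]
        exact le_abs_self _)
    set T := 1 + 32 * Real.exp 1 + 8 * Real.exp 1 ^ 2 * (1 / α) ^ (1 / α) * (4 ^ (1 / α) + 4)
      with hT
    have hT' : 0 ≤ 8 * Real.exp 1 ^ 2 * (1 / α) ^ (1 / α) * (4 ^ (1 / α) + 4) := by positivity
    have he : 0 < Real.exp 1 := Real.exp_pos 1
    have htail := eLpNorm_tail_le hα hL ha hA hX hp hM (T := T) (by linarith) (by linarith)
      (by linarith) (G := Fᶜ) (fun i hi => by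
        rw [Finset.mem_compl, hF, Finset.mem_filter] at hi
        push Not at hi
        exact (hi (Finset.mem_univ i)).le)
    have hm : ∀ s : Finset (Fin n), AEStronglyMeasurable (fun ω => ∑ i ∈ s, a i * X i ω) P :=
      fun s => (Finset.measurable_sum _ fun i _ =>
        (hX.measurable i).const_mul _).aestronglyMeasurable
    have hsplit : (fun ω => ∑ i, a i * X i ω) =
        (fun ω => ∑ i ∈ F, a i * X i ω) + fun ω => ∑ i ∈ Fᶜ, a i * X i ω := by
      ext ω
      exact (Finset.sum_add_sum_compl F _).symm
    have hT0 : 0 ≤ T := by linarith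
    rw [hsplit]
    refine (eLpNorm_add_le (hm F) (hm Fᶜ) (by rwa [ENNReal.one_le_ofReal])).trans
      ((add_le_add hhead htail).trans ?_)
    rw [← hD, ← hN, ← hMdef, ← ENNReal.ofReal_add (by positivity) (by positivity)]
    apply ENNReal.ofReal_le_ofReal
    have h1 : (1 / 2 * p) ^ (1 / 2 : ℝ) ≤ Real.sqrt p := by
      rw [Real.sqrt_eq_rpow]
      gcongr
      linarith
    have h2 : (1 / α * p) ^ (1 / α) = (1 / α) ^ (1 / α) * p ^ (1 / α) :=
      Real.mul_rpow (by positivity) hp0.le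
    calc 2 * D * (2 * (1 / 2 * p) ^ (1 / 2 : ℝ)) + 2 * N * (2 * (1 / α * p) ^ (1 / α)) +
          T * Real.exp (seriesConst α * 4) * M
        ≤ 2 * D * (2 * Real.sqrt p) + 2 * N * (2 * ((1 / α) ^ (1 / α) * p ^ (1 / α))) +
          T * Real.exp (seriesConst α * 4) * M := by rw [h2]; gcongr
      _ = 4 * (Real.sqrt p * D) + 4 * (1 / α) ^ (1 / α) * (p ^ (1 / α) * N) +
          T * Real.exp (seriesConst α * 4) * M := by ring
      _ ≤ 4 * M + 4 * (1 / α) ^ (1 / α) * M + T * Real.exp (seriesConst α * 4) * M := by gcongr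
      _ = upperConst α * M := by rw [upperConst]; ring

lemma worstMoment_le {n : ℕ} {α : ℝ} (hα : 0 < α) {L a : Fin n → ℝ} (hL : ∀ i, 0 ≤ L i)
    (ha : ∀ i, 0 ≤ a i) (hA : Antitone fun i => a i * Lbar L i) {p : ℝ} (hp : 1 ≤ p) :
    worstMoment.{u} α L a p ≤ ENNReal.ofReal (upperConst α * momentBound α L a p) :=
  iSup_le fun _ => iSup_le fun _ => iSup_le fun _ => iSup_le fun _ => iSup_le fun _ =>
    iSup_le fun hX => eLpNorm_sum_le_momentBound hα hL ha hA hX hp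

/-! ### The lower bound: Weibull part -/

lemma pi_map_ulift_symm_map {n : ℕ} (ν : Fin n → Measure ℝ) [∀ i, IsProbabilityMeasure (ν i)] :
    ((Measure.pi ν).map (MeasurableEquiv.ulift.{0, u} (α := Fin n → ℝ)).symm).map
      (fun ω => ω.down) = Measure.pi ν := by
  rw [Measure.map_map measurable_down (MeasurableEquiv.measurable _)]
  exact Measure.map_id

lemma measurable_linear_pi {n : ℕ} (a : Fin n → ℝ) :
    Measurable fun x : Fin n → ℝ => ∑ i, a i * x i :=
  Finset.measurable_sum _ fun i _ => (measurable_pi_apply i).const_mul _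

/-- Independent variables with prescribed laws, realised in an arbitrary universe. -/
lemma eLpNorm_pi_le_worstMoment {n : ℕ} {α : ℝ} {L a : Fin n → ℝ} {p : ℝ}
    (ν : Fin n → Measure ℝ) [∀ i, IsProbabilityMeasure (ν i)]
    (hint : ∀ i, Integrable (fun x => x) (ν i)) (hmean : ∀ i, ∫ x, x ∂ν i = 0)
    (hφ : ∀ i, ∫⁻ x, ENNReal.ofReal (phi α (L i) |x|) ∂ν i ≤ 1) :
    eLpNorm (fun x : Fin n → ℝ => ∑ i, a i * x i) (ENNReal.ofReal p) (Measure.pi ν) ≤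
      worstMoment.{u} α L a p := by
  set P := (Measure.pi ν).map (MeasurableEquiv.ulift.{0, u} (α := Fin n → ℝ)).symm with hP
  have : IsProbabilityMeasure P :=
    Measure.isProbabilityMeasure_map (MeasurableEquiv.measurable _).aemeasurable
  set X : Fin n → ULift.{u} (Fin n → ℝ) → ℝ := fun i ω => ω.down i with hX
  have hXm : ∀ i, Measurable (X i) := fun i => (measurable_pi_apply i).comp measurable_down
  have hdown : P.map (fun ω => ω.down) = Measure.pi ν := pi_map_ulift_symm_map ν
  have hlaw : ∀ i, P.map (X i) = ν i := by
    intro i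
    rw [← (measurePreserving_eval ν i).map_eq, ← hdown,
      Measure.map_map (measurable_pi_apply i) measurable_down]
    rfl
  have hmem : MemClass P α L X := by
    refine ⟨hXm, fun i => ?_, fun i => ?_, fun i => ?_, ?_⟩
    · have h := hint i
      rw [← hlaw i] at h
      exact h.comp_measurable (hXm i)
    · rw [← hmean i, ← hlaw i, integral_map (hXm i).aemeasurable (by fun_prop)]
    · refine (iInf₂_le_of_le 1 one_pos (iInf_le_of_le ?_ (by simp)))
      have hm : Measurable fun x : ℝ => ENNReal.ofReal (phi α (L i) |x|) := by
        have := measurable_phiExp α (L i)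
        simp_rw [phi_eq]
        fun_prop
      have h := hφ i
      rw [← hlaw i, lintegral_map hm (hXm i)] at h
      simpa using h
    · rw [iIndepFun_iff_map_fun_eq_pi_map fun i => (hXm i).aemeasurable]
      simp_rw [hlaw]
      exact hdown
  have hnorm : eLpNorm (fun x : Fin n → ℝ => ∑ i, a i * x i) (ENNReal.ofReal p) (Measure.pi ν) =
      eLpNorm (fun ω => ∑ i, a i * X i ω) (ENNReal.ofReal p) P := by
    rw [← hdown, eLpNorm_map_measure (measurable_linear_pi a).aestronglyMeasurable
      measurable_down.aemeasurable]
    rfl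
  rw [hnorm]
  exact le_iSup_of_le _ <| le_iSup_of_le _ <| le_iSup_of_le P <| le_iSup_of_le this <|
    le_iSup_of_le X <| le_iSup_of_le hmem le_rfl

/-- Markov's inequality read backwards: an event of probability κ^p costs only the factor κ in the
p-norm. -/
lemma ofReal_mul_le_eLpNorm {Ω : Type*} [MeasurableSpace Ω] {P : Measure Ω} {f : Ω → ℝ}
    (hf : AEStronglyMeasurable f P) {p κ ε : ℝ} (hp : 1 ≤ p) (hκ : 0 ≤ κ) (hε : 0 ≤ ε)
    (h : ENNReal.ofReal (κ ^ p) ≤ P {ω | ε ≤ |f ω|}) :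
    ENNReal.ofReal (κ * ε) ≤ eLpNorm f (ENNReal.ofReal p) P := by
  have hp0 : 0 < p := by linarith
  have h1 := mul_meas_ge_le_pow_eLpNorm' P (p := ENNReal.ofReal p) (by simpa using hp0) (by simp)
    hf (ENNReal.ofReal ε)
  rw [ENNReal.toReal_ofReal hp0.le] at h1
  rw [← ENNReal.rpow_le_rpow_iff hp0]
  refine le_trans ?_ h1
  have hset : {ω | ENNReal.ofReal ε ≤ ‖f ω‖ₑ} = {ω | ε ≤ |f ω|} := by
    ext ω
    simp only [Set.mem_ofPred_eq, Real.enorm_eq_ofReal_abs]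
    exact ENNReal.ofReal_le_ofReal_iff (abs_nonneg _)
  rw [hset, mul_comm κ, ENNReal.ofReal_mul hε, ENNReal.mul_rpow_of_nonneg _ _ hp0.le,
    ENNReal.ofReal_rpow_of_nonneg hκ hp0.le]
  gcongr

/-- The law taking the values `± v` with probability `e^{-s} / 2` each, and `0` otherwise. -/
noncomputable def threePoint (s v : ℝ) : Measure ℝ :=
  ENNReal.ofReal (Real.exp (-s) / 2) • Measure.dirac v +
    ENNReal.ofReal (Real.exp (-s) / 2) • Measure.dirac (-v) +
    ENNReal.ofReal (1 - Real.exp (-s)) • Measure.dirac 0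

lemma isProbabilityMeasure_threePoint {s : ℝ} (hs : 0 ≤ s) (v : ℝ) :
    IsProbabilityMeasure (threePoint s v) := by
  have h1 : Real.exp (-s) ≤ 1 := Real.exp_le_one_iff.mpr (by linarith)
  refine ⟨?_⟩
  simp only [threePoint, Measure.add_apply, Measure.smul_apply, measure_univ, smul_eq_mul, mul_one]
  rw [← ENNReal.ofReal_add (by positivity) (by positivity),
    ← ENNReal.ofReal_add (by positivity) (by linarith)]
  simp

lemma integrable_threePoint (s v : ℝ) (f : ℝ → ℝ) : Integrable f (threePoint s v) := by
  refine ((Integrable.smul_measure ?_ (by simp)).add_measure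
    (Integrable.smul_measure ?_ (by simp))).add_measure (Integrable.smul_measure ?_ (by simp)) <;>
  exact integrable_dirac (by simp)

lemma integral_id_threePoint (s v : ℝ) : ∫ x, x ∂threePoint s v = 0 := by
  have hd : ∀ (c x : ℝ), Integrable (fun x : ℝ => x) (ENNReal.ofReal c • Measure.dirac x) :=
    fun c x => (integrable_dirac (by simp)).smul_measure (by simp)
  rw [threePoint, integral_add_measure ((hd _ _).add_measure (hd _ _)) (hd _ _),
    integral_add_measure (hd _ _) (hd _ _)]
  simp [integral_smul_measure]

/-- The total mass exp(-s) at ±v exactly balances the bound exp(s) for `phi` there, and `phi`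
vanishes at 0. -/
lemma lintegral_phi_threePoint_le {α L s v : ℝ} (hα : 0 < α) (hv : phiExp α L |v| ≤ s) :
    ∫⁻ x, ENNReal.ofReal (phi α L |x|) ∂threePoint s v ≤ 1 := by
  have h0 : phi α L 0 = 0 := by
    simp [phi, Real.zero_rpow hα.ne']
  have hv' : phi α L |v| ≤ Real.exp s - 1 := by
    rw [phi_eq]; simpa using hv
  simp only [threePoint, lintegral_add_measure, lintegral_smul_measure, lintegral_dirac, abs_neg,
    abs_zero, h0, ENNReal.ofReal_zero, smul_eq_mul, mul_zero, add_zero]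
  calc _ ≤ ENNReal.ofReal (Real.exp (-s) / 2) * ENNReal.ofReal (Real.exp s) +
        ENNReal.ofReal (Real.exp (-s) / 2) * ENNReal.ofReal (Real.exp s) := by
        gcongr <;> linarith
    _ = 1 := by
        rw [← ENNReal.ofReal_mul (by positivity),
          ← ENNReal.ofReal_add (by positivity) (by positivity), ← add_mul, add_halves,
          ← Real.exp_add]
        simp

lemma ofReal_le_threePoint_singleton (s v : ℝ) :
    ENNReal.ofReal (Real.exp (-s) / 2) ≤ threePoint s v {v} := by
  simp only [threePoint, Measure.add_apply, Measure.smul_apply, smul_eq_mul]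
  refine le_add_right (le_add_right ?_)
  simp

lemma threePoint_zero_zero : threePoint 0 0 = Measure.dirac 0 := by
  have h : (2⁻¹ : ℝ≥0∞) + 2⁻¹ = 1 := ENNReal.inv_two_add_inv_two
  ext A hA
  simp only [threePoint, Measure.add_apply, Measure.smul_apply, smul_eq_mul, neg_zero,
    Real.exp_zero, sub_self, ENNReal.ofReal_zero, zero_mul, add_zero, ← add_mul]
  rw [← ENNReal.ofReal_add (by norm_num) (by norm_num)]
  norm_num

lemma phiExp_mul_le {α L t : ℝ} (hL : 0 ≤ L) (ht : 0 ≤ t) :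
    phiExp α L |L * t| ≤ t ^ α := by
  rw [abs_of_nonneg (by positivity)]
  rcases eq_or_ne L 0 with h | h
  · simpa [phiExp, h] using Real.rpow_nonneg ht α
  · simp only [phiExp, h, if_false]
    refine (min_le_right _ _).trans (le_of_eq ?_)
    rw [mul_div_cancel_left₀ _ h]

/-- All variables sit at L_i t_i together with probability at least 2^(-|F|) exp(-∑ t_i^α) ≥
(2e)^(-p). Indices outside F have the law δ_0 and contribute a factor 1. -/
lemma ofReal_sum_le_worstMoment {n : ℕ} {α : ℝ} (hα : 0 < α) {L a : Fin n → ℝ}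
    (hL : ∀ i, 0 ≤ L i) (ha : ∀ i, 0 ≤ a i) {p : ℝ} (hp : 1 ≤ p) {F : Finset (Fin n)}
    {t : Fin n → ℝ} (ht : ∀ i, 0 ≤ t i) (htF : ∀ i ∉ F, t i = 0) (hF : (F.card : ℝ) ≤ p)
    (hsum : ∑ i ∈ F, t i ^ α ≤ p) :
    ENNReal.ofReal (1 / (2 * Real.exp 1) * ∑ i, a i * (L i * t i)) ≤ worstMoment.{u} α L a p := by
  set ν : Fin n → Measure ℝ := fun i => threePoint (t i ^ α) (L i * t i) with hν
  have hprob : ∀ i, IsProbabilityMeasure (ν i) := fun i =>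
    isProbabilityMeasure_threePoint (Real.rpow_nonneg (ht i) _) _
  refine le_trans ?_ (eLpNorm_pi_le_worstMoment.{u} (a := a) (p := p) ν
    (fun i => integrable_threePoint _ _ _) (fun i => integral_id_threePoint _ _)
    (fun i => lintegral_phi_threePoint_le hα (phiExp_mul_le (hL i) (ht i))))
  have hS : 0 ≤ ∑ i, a i * (L i * t i) := Finset.sum_nonneg fun i _ =>
    mul_nonneg (ha i) (mul_nonneg (hL i) (ht i))
  refine ofReal_mul_le_eLpNorm (measurable_linear_pi a).aestronglyMeasurable hp (by positivity) hS ?_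
  have hsub : Set.univ.pi (fun i => {L i * t i}) ⊆
      {x : Fin n → ℝ | ∑ i, a i * (L i * t i) ≤ |∑ i, a i * x i|} := by
    intro x hx
    have hx' : ∀ i, x i = L i * t i := fun i => by simpa using hx i (Set.mem_univ i)
    simp only [Set.mem_ofPred_eq, hx']
    exact le_abs_self _
  refine le_trans ?_ (measure_mono hsub)
  rw [Measure.pi_pi]
  calc ENNReal.ofReal ((1 / (2 * Real.exp 1)) ^ p)
      ≤ ENNReal.ofReal (∏ i ∈ F, Real.exp (-(t i ^ α)) / 2) := by
        apply ENNReal.ofReal_le_ofReal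
        rw [Finset.prod_div_distrib, ← Real.exp_sum, Finset.sum_neg_distrib, Finset.prod_const,
          Real.div_rpow zero_le_one (by positivity), Real.one_rpow,
          Real.mul_rpow (by norm_num) (by positivity), ← Real.exp_mul, one_mul, Real.exp_neg,
          mul_comm, ← one_div_mul_one_div, ← one_div, div_eq_mul_one_div (1 / Real.exp _)]
        gcongr
        rw [← Real.rpow_natCast]
        exact Real.rpow_le_rpow_of_exponent_le (by norm_num) hF
    _ = ∏ i ∈ F, ENNReal.ofReal (Real.exp (-(t i ^ α)) / 2) :=
        ENNReal.ofReal_prod_of_nonneg fun i _ => by positivity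
    _ ≤ ∏ i ∈ F, ν i {L i * t i} :=
        Finset.prod_le_prod' fun i _ => ofReal_le_threePoint_singleton _ _
    _ = ∏ i, ν i {L i * t i} := by
        refine Finset.prod_subset (Finset.subset_univ F) fun i _ hi => ?_
        simp [hν, htF i hi, Real.zero_rpow hα.ne', threePoint_zero_zero]

/-- Extremal vectors in the duality between `ℓ^α` and `ℓ^β`. -/
lemma exists_dual_weights {n : ℕ} {α : ℝ} (hα : 0 < α) {L a : Fin n → ℝ} (hL : ∀ i, 0 ≤ L i)
    (ha : ∀ i, 0 ≤ a i) {p : ℝ} (hp : 1 ≤ p) :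
    ∃ (F : Finset (Fin n)) (t : Fin n → ℝ), (∀ i, 0 ≤ t i) ∧ (∀ i ∉ F, t i = 0) ∧
      (F.card : ℝ) ≤ p ∧ ∑ i ∈ F, t i ^ α ≤ p ∧
      p ^ (1 / α) * vecNorm (conjExp α) (heavyPart α L a p) ≤ ∑ i, a i * (L i * t i) := by
  have hp0 : 0 < p := by linarith
  set h := heavyPart α L a p with hh
  have hh0 : ∀ i, 0 ≤ h i := by
    intro i
    rw [hh, heavyPart]
    split_ifs
    · exact mul_nonneg (ha i) (hL i)
    · exact le_rfl
  set N := vecNorm (conjExp α) h with hN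
  have hN0 : 0 ≤ N := vecNorm_nonneg one_le_conjExp _
  rcases hN0.eq_or_lt with hNz | hNpos
  · refine ⟨∅, 0, by simp, by simp, by simpa using hp0.le, by simpa using hp0.le, ?_⟩
    rw [← hNz]; simp
  rcases le_or_gt α 1 with h1 | h1
  · have hne : Nonempty (Fin n) := by
      by_contra hne
      rw [not_nonempty_iff] at hne
      rw [hN, vecNorm_conjExp_of_le_one h1, Real.iSup_of_isEmpty] at hNpos
      exact lt_irrefl _ hNpos
    obtain ⟨i₀, hi₀⟩ := exists_eq_ciSup_of_finite (f := fun i => |h i|)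
    have hN' : N = a i₀ * L i₀ := by
      rw [hN, vecNorm_conjExp_of_le_one h1, ← hi₀, abs_of_nonneg (hh0 i₀), hh, heavyPart,
        if_pos (Or.inl h1)]
    -- For the sup norm the extremal weight is concentrated at a maximiser.
    refine ⟨{i₀}, Pi.single i₀ (p ^ (1 / α)), fun i => ?_, fun i hi => ?_, by simpa using hp, ?_, ?_⟩
    · rcases eq_or_ne i i₀ with rfl | hne
      · rw [Pi.single_eq_same]; positivity
      · rw [Pi.single_eq_of_ne hne]
    · rw [Pi.single_eq_of_ne (by simpa using hi)]
    · rw [Finset.sum_singleton, Pi.single_eq_same, ← Real.rpow_mul hp0.le,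
        one_div_mul_cancel hα.ne', Real.rpow_one]
    · rw [Finset.sum_eq_single i₀ (fun i _ hne => by rw [Pi.single_eq_of_ne hne]; simp) (by simp),
        Pi.single_eq_same, hN']
      exact le_of_eq (by ring)
  · set β := α / (α - 1) with hβ
    have hα1 : 0 < α - 1 := by linarith
    have hβ0 : 0 < β := div_pos hα hα1
    have hβ1 : 0 < β - 1 := by
      rw [hβ, div_sub_one hα1.ne']; exact div_pos (by linarith) hα1
    have hβα : (β - 1) * α = β := by rw [hβ]; field_simp; ring
    have hr0 : ∀ i, 0 ≤ h i / N := fun i => div_nonneg (hh0 i) hN0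
    have hNβ : N ^ β = ∑ i, h i ^ β := by
      rw [hN, vecNorm_conjExp_of_one_lt h1, ← Real.rpow_mul (Finset.sum_nonneg fun i _ => by
        positivity), one_div_mul_cancel hβ0.ne', Real.rpow_one]
      exact Finset.sum_congr rfl fun i _ => by rw [abs_of_nonneg (hh0 i)]
    have hsum1 : ∑ i, (h i / N) ^ β = 1 := by
      have : ∀ i, (h i / N) ^ β = h i ^ β / N ^ β := fun i => Real.div_rpow (hh0 i) hN0 _
      simp_rw [this]
      rw [← Finset.sum_div, ← hNβ, div_self (Real.rpow_pos_of_pos hNpos _).ne']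
    -- Equality case of Hölder, normalised so that ∑ t_i^α = p, using (β - 1) α = β.
    refine ⟨Finset.univ.filter fun i : Fin n => ((i : ℕ) : ℝ) + 1 ≤ p,
      fun i => p ^ (1 / α) * (h i / N) ^ (β - 1), fun i => ?_, fun i hi => ?_,
      card_filter_add_one_le hp0.le, ?_, ?_⟩
    · have := hr0 i
      positivity
    · have hi' : ¬ (α ≤ 1 ∨ ((i : ℕ) : ℝ) + 1 ≤ p) := by
        simp only [Finset.mem_filter, Finset.mem_univ, true_and] at hi
        exact not_or.mpr ⟨h1.not_ge, hi⟩
      have hz : h i = 0 := by rw [hh, heavyPart, if_neg hi']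
      simp only [hz, zero_div, Real.zero_rpow hβ1.ne', mul_zero]
    · have e : ∀ i, (p ^ (1 / α) * (h i / N) ^ (β - 1)) ^ α = p * (h i / N) ^ β := by
        intro i
        rw [Real.mul_rpow (by positivity) (Real.rpow_nonneg (hr0 i) _), ← Real.rpow_mul hp0.le,
          ← Real.rpow_mul (hr0 i), hβα, one_div_mul_cancel hα.ne', Real.rpow_one]
      simp_rw [e]
      calc _ ≤ ∑ i, p * (h i / N) ^ β :=
            Finset.sum_le_sum_of_subset_of_nonneg (Finset.subset_univ _) fun i _ _ =>
              mul_nonneg hp0.le (Real.rpow_nonneg (hr0 i) _)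
        _ = p := by rw [← Finset.mul_sum, hsum1, mul_one]
    · calc p ^ (1 / α) * N = ∑ i, p ^ (1 / α) * N * (h i / N) ^ β := by
            rw [← Finset.mul_sum, hsum1, mul_one]
        _ ≤ _ := by
            refine Finset.sum_le_sum fun i _ => ?_
            have hle : h i ≤ a i * L i := by
              rw [hh, heavyPart]
              split_ifs
              · exact le_rfl
              · exact mul_nonneg (ha i) (hL i)
            have hsplit : (h i / N) ^ β = h i / N * (h i / N) ^ (β - 1) := by
              rcases (hr0 i).eq_or_lt with hz | hz
              · rw [← hz, Real.zero_rpow hβ0.ne', zero_mul]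
              · rw [Real.rpow_sub_one hz.ne']
                generalize h i / N = r at hz ⊢
                field_simp
            calc p ^ (1 / α) * N * (h i / N) ^ β
                = h i * (p ^ (1 / α) * (h i / N) ^ (β - 1)) := by
                  rw [hsplit]; field_simp
              _ ≤ a i * L i * (p ^ (1 / α) * (h i / N) ^ (β - 1)) := by
                  have := hr0 i
                  gcongr
              _ = _ := by ring

lemma weibull_le_worstMoment {n : ℕ} {α : ℝ} (hα : 0 < α) {L a : Fin n → ℝ} (hL : ∀ i, 0 ≤ L i)
    (ha : ∀ i, 0 ≤ a i) {p : ℝ} (hp : 1 ≤ p) :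
    ENNReal.ofReal (1 / (2 * Real.exp 1) *
      (p ^ (1 / α) * vecNorm (conjExp α) (heavyPart α L a p))) ≤ worstMoment.{u} α L a p := by
  obtain ⟨F, t, ht, htF, hF, hsum, hle⟩ := exists_dual_weights hα hL ha hp
  refine le_trans (ENNReal.ofReal_le_ofReal ?_)
    (ofReal_sum_le_worstMoment.{u} hα hL ha hp ht htF hF hsum)
  gcongr

/-! ### The lower bound: Gaussian part -/

/-- `‖G‖_p ≥ e⁻⁴ √p` for a standard Gaussian `G`. -/
lemma ofReal_le_eLpNorm_gaussianReal {p : ℝ} (hp : 1 ≤ p) :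
    ENNReal.ofReal (Real.exp (-4) * Real.sqrt p) ≤
      eLpNorm (fun x : ℝ => x) (ENNReal.ofReal p) (gaussianReal 0 1) := by
  have hp0 : 0 ≤ p := by linarith
  have hs1 : 1 ≤ Real.sqrt p := Real.one_le_sqrt.mpr hp
  refine ofReal_mul_le_eLpNorm (by fun_prop) hp (Real.exp_pos _).le (Real.sqrt_nonneg _) ?_
  -- This interval has length at least 1, and on it the density is at least e^(-2) e^(-2p) ≥
  -- e^(-4p).
  have hsub : Set.Icc (Real.sqrt p) (2 * Real.sqrt p) ⊆ {x : ℝ | Real.sqrt p ≤ |x|} :=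
    fun x hx => hx.1.trans (le_abs_self x)
  refine le_trans ?_ (measure_mono hsub)
  rw [gaussianReal_apply 0 one_ne_zero]
  have hpdf : ∀ x ∈ Set.Icc (Real.sqrt p) (2 * Real.sqrt p),
      ENNReal.ofReal (Real.exp (-4) ^ p) ≤ gaussianPDF 0 1 x := by
    intro x hx
    apply ENNReal.ofReal_le_ofReal
    rw [gaussianPDFReal]
    have hx2 : x ^ 2 ≤ 4 * p := by
      calc x ^ 2 ≤ (2 * Real.sqrt p) ^ 2 := by
            have := hx.1
            gcongr
            · linarith
            · exact hx.2
        _ = 4 * p := by rw [mul_pow, Real.sq_sqrt hp0]; norm_num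
    have hc : Real.exp (-2) ≤ (√(2 * Real.pi * (1 : NNReal)))⁻¹ := by
      have h3 : √(2 * Real.pi * (1 : NNReal)) ≤ 3 := by
        rw [Real.sqrt_le_left (by norm_num)]
        have := Real.pi_lt_d2
        norm_num; linarith
      have hpos : 0 < √(2 * Real.pi * (1 : NNReal)) := by
        apply Real.sqrt_pos.mpr
        have := Real.pi_pos
        norm_num [this]
      rw [Real.exp_neg]
      gcongr
      have := Real.add_one_le_exp 2
      linarith
    calc Real.exp (-4) ^ p = Real.exp (-2 * p) * Real.exp (-2 * p) := by
          rw [← Real.exp_mul, ← Real.exp_add]; ring_nf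
      _ ≤ Real.exp (-2) * Real.exp (-(x - 0) ^ 2 / (2 * (1 : NNReal))) := by
          gcongr
          · linarith
          · norm_num; linarith
      _ ≤ _ := by gcongr
  calc ENNReal.ofReal (Real.exp (-4) ^ p)
      ≤ ENNReal.ofReal (Real.exp (-4) ^ p) * volume (Set.Icc (Real.sqrt p) (2 * Real.sqrt p)) := by
        refine le_mul_of_one_le_right zero_le ?_
        rw [Real.volume_Icc, ENNReal.one_le_ofReal]
        linarith
    _ = ∫⁻ _ in Set.Icc (Real.sqrt p) (2 * Real.sqrt p), ENNReal.ofReal (Real.exp (-4) ^ p) := by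
        rw [setLIntegral_const]
    _ ≤ _ := setLIntegral_mono (measurable_gaussianPDF 0 1) hpdf

lemma integral_exp_sq_gaussianReal :
    ∫ x, Real.exp ((1 + x ^ 2) / 8) ∂gaussianReal 0 1 = Real.exp (1 / 8) * √(4 / 3) := by
  rw [integral_gaussianReal_eq_integral_smul one_ne_zero]
  have h : ∀ x : ℝ, gaussianPDFReal 0 1 x • Real.exp ((1 + x ^ 2) / 8) =
      (√(2 * Real.pi))⁻¹ * Real.exp (1 / 8) * Real.exp (-(3 / 8) * x ^ 2) := by
    intro x
    rw [gaussianPDFReal, smul_eq_mul, mul_assoc _ (Real.exp _), mul_assoc _ (Real.exp _),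
      ← Real.exp_add, ← Real.exp_add]
    simp only [NNReal.coe_one, mul_one, sub_zero]
    congr 2
    ring
  simp_rw [h]
  rw [integral_const_mul, integral_gaussian, mul_comm _ (Real.exp (1 / 8)), mul_assoc,
    ← Real.sqrt_inv, ← Real.sqrt_mul (by positivity)]
  congr 2
  field_simp
  norm_num

lemma integral_exp_sq_gaussianReal_le :
    Integrable (fun x : ℝ => Real.exp ((1 + x ^ 2) / 8)) (gaussianReal 0 1) ∧
      ∫ x, Real.exp ((1 + x ^ 2) / 8) ∂gaussianReal 0 1 ≤ 2 := by
  refine ⟨Integrable.of_integral_ne_zero ?_, ?_⟩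
  · rw [integral_exp_sq_gaussianReal]; positivity
  · rw [integral_exp_sq_gaussianReal]
    have h1 : √(4 / 3) ≤ 5 / 4 := by
      rw [Real.sqrt_le_left (by norm_num)]; norm_num
    have h2 : Real.exp (1 / 8) ≤ 6 / 5 := by
      refine le_of_pow_le_pow_left₀ (n := 8) (by norm_num) (by norm_num) ?_
      rw [← Real.exp_nat_mul]
      have := Real.exp_one_lt_d9
      norm_num
      linarith
    nlinarith [Real.exp_pos (1 / 8), Real.sqrt_nonneg (4 / 3)]

/-- Stability of the Gaussian law: the characteristic function of the sum factorises, and the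
exponents add up to -t²‖w‖₂²/2. -/
lemma map_pi_gaussianReal_sum {n : ℕ} (w : Fin n → ℝ) :
    (Measure.pi fun _ : Fin n => gaussianReal 0 1).map (fun x => ∑ i, w i * x i) =
      (gaussianReal 0 1).map (fun x => vecNorm 2 w * x) := by
  have hm : Measurable fun x : Fin n → ℝ => ∑ i, w i * x i := measurable_linear_pi w
  have : IsProbabilityMeasure
      ((Measure.pi fun _ : Fin n => gaussianReal 0 1).map (fun x => ∑ i, w i * x i)) :=
    Measure.isProbabilityMeasure_map hm.aemeasurable
  rw [gaussianReal_map_const_mul]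
  apply Measure.ext_of_charFun
  ext t
  rw [charFun_gaussianReal, charFun_apply_real, integral_map hm.aemeasurable (by fun_prop)]
  have h1 : ∀ x : Fin n → ℝ, Complex.exp (t * (∑ i, w i * x i : ℝ) * Complex.I) =
      ∏ i, Complex.exp ((t * w i : ℝ) * x i * Complex.I) := by
    intro x
    rw [← Complex.exp_sum]
    congr 1
    push_cast
    rw [Finset.mul_sum, Finset.sum_mul]
    exact Finset.sum_congr rfl fun i _ => by ring
  simp_rw [h1]
  rw [integral_fintype_prod_eq_prod (f := fun i (x : ℝ) =>
    Complex.exp ((t * w i : ℝ) * x * Complex.I))]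
  simp_rw [← charFun_apply_real, charFun_gaussianReal]
  rw [← Complex.exp_sum]
  congr 1
  have h2 : ((vecNorm 2 w : ℂ)) ^ 2 = ∑ i, (w i : ℂ) ^ 2 := by
    exact_mod_cast vecNorm_two_sq w
  simp only [mul_zero, Complex.ofReal_zero, zero_mul, zero_sub, NNReal.coe_one, mul_one,
    Complex.ofReal_one, one_mul, NNReal.coe_mk, Complex.ofReal_pow, h2, Complex.ofReal_mul]
  rw [Finset.sum_neg_distrib, ← Finset.sum_div, Finset.sum_mul]
  congr 2
  exact Finset.sum_congr rfl fun i _ => by ring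

/-- The factor c = (1/8)^(1/α) has c^α = 1/8, and c² ≤ 1/8 because α ≤ 2. For L ≤ 1 the quadratic
branch is used; for L > 1 the Weibull branch with |y|^α ≤ 1 + y², again by α ≤ 2. -/
lemma phiExp_gaussian_le {α L : ℝ} (hα : 0 < α) (hα2 : α ≤ 2) (y : ℝ) :
    phiExp α L |(1 / 8) ^ (1 / α) * max 1 L * y| ≤ (1 + y ^ 2) / 8 := by
  set c : ℝ := (1 / 8) ^ (1 / α) with hc
  have hc0 : 0 ≤ c := by positivity
  have hcα : c ^ α = 1 / 8 := by
    rw [hc, ← Real.rpow_mul (by norm_num), one_div_mul_cancel hα.ne', Real.rpow_one]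
  rcases le_or_gt L 1 with h | h
  · have hc2 : c ^ 2 ≤ 1 / 8 := by
      rw [hc, ← Real.rpow_two, ← Real.rpow_mul (by norm_num)]
      refine (Real.rpow_le_rpow_of_exponent_ge (by norm_num) (by norm_num) ?_).trans_eq
        (Real.rpow_one _)
      rw [div_mul_eq_mul_div, one_mul, le_div_iff₀ hα]
      linarith
    have h2 : phiExp α L |c * max 1 L * y| ≤ |c * max 1 L * y| ^ 2 := by
      unfold phiExp
      split_ifs
      · exact le_rfl
      · exact min_le_left _ _
    refine h2.trans ?_
    rw [max_eq_left h, sq_abs, mul_one, mul_pow]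
    nlinarith [sq_nonneg y]
  · have hL0 : 0 < L := by linarith
    have h2 : phiExp α L |c * max 1 L * y| ≤ (|c * max 1 L * y| / L) ^ α := by
      rw [phiExp, if_neg hL0.ne']
      exact min_le_right _ _
    refine h2.trans ?_
    have h3 : |c * max 1 L * y| / L = c * |y| := by
      rw [max_eq_right h.le, abs_mul, abs_of_nonneg (by positivity : 0 ≤ c * L)]
      field_simp
    have h4 : |y| ^ α ≤ 1 + y ^ 2 := by
      rcases le_total |y| 1 with hy | hy
      · have := Real.rpow_le_one (abs_nonneg y) hy hα.le
        nlinarith [sq_nonneg y]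
      · have := Real.rpow_le_rpow_of_exponent_le hy hα2
        rw [Real.rpow_two, sq_abs] at this
        linarith
    rw [h3, Real.mul_rpow hc0 (abs_nonneg y), hcα]
    linarith

lemma lintegral_phi_gaussian_le {α L : ℝ} (hα : 0 < α) (hα2 : α ≤ 2) :
    ∫⁻ y, ENNReal.ofReal (phi α L |(1 / 8) ^ (1 / α) * max 1 L * y|) ∂gaussianReal 0 1 ≤ 1 := by
  obtain ⟨hi, hle⟩ := integral_exp_sq_gaussianReal_le
  calc _ ≤ ∫⁻ y, ENNReal.ofReal (Real.exp ((1 + y ^ 2) / 8) - 1) ∂gaussianReal 0 1 := by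
        refine lintegral_mono fun y => ENNReal.ofReal_le_ofReal ?_
        rw [phi_eq]
        simpa using phiExp_gaussian_le hα hα2 y
    _ = ENNReal.ofReal (∫ y, (Real.exp ((1 + y ^ 2) / 8) - 1) ∂gaussianReal 0 1) := by
        have hi' : Integrable (fun y : ℝ => Real.exp ((1 + y ^ 2) / 8) - 1) (gaussianReal 0 1) :=
          hi.sub (integrable_const 1)
        rw [ofReal_integral_eq_lintegral_ofReal hi']
        refine Filter.Eventually.of_forall fun y => ?_
        have := Real.one_le_exp (show 0 ≤ (1 + y ^ 2) / 8 by positivity)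
        simpa using this
    _ ≤ ENNReal.ofReal 1 := by
        apply ENNReal.ofReal_le_ofReal
        rw [integral_sub hi (integrable_const 1)]
        simp only [integral_const, probReal_univ, smul_eq_mul, mul_one]
        linarith
    _ = 1 := ENNReal.ofReal_one

/-- Taking X_i = c L̄_i G_i with independent standard Gaussians G_i, the weighted sum is distributed
as c ‖a ⊙ L̄‖₂ G. -/
lemma gaussian_le_worstMoment {n : ℕ} {α : ℝ} (hα : 0 < α) (hα2 : α ≤ 2) {L a : Fin n → ℝ}
    {p : ℝ} (hp : 1 ≤ p) :
    ENNReal.ofReal ((1 / 8) ^ (1 / α) * Real.exp (-4) *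
      (Real.sqrt p * vecNorm 2 (fun i => a i * Lbar L i))) ≤ worstMoment.{u} α L a p := by
  set c : ℝ := (1 / 8) ^ (1 / α) with hc
  have hc0 : 0 ≤ c := by positivity
  set D := vecNorm 2 (fun i => a i * Lbar L i) with hD
  have hD0 : 0 ≤ D := vecNorm_nonneg (by norm_num) _
  have hsm : ∀ i, Measurable fun y : ℝ => c * Lbar L i * y := fun i => by fun_prop
  set ν : Fin n → Measure ℝ := fun i => (gaussianReal 0 1).map fun y => c * Lbar L i * y with hν
  have hprob : ∀ i, IsProbabilityMeasure (ν i) := fun i =>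
    Measure.isProbabilityMeasure_map (hsm i).aemeasurable
  have hid : Integrable (fun y : ℝ => y) (gaussianReal 0 1) := IsGaussian.integrable_id
  have hlow := eLpNorm_pi_le_worstMoment.{u} (α := α) (L := L) (a := a) (p := p) ν
    (fun i => by
      rw [hν, integrable_map_measure (by fun_prop) (hsm i).aemeasurable]
      exact hid.const_mul _)
    (fun i => by
      rw [hν, integral_map (hsm i).aemeasurable (by fun_prop), integral_const_mul,
        integral_id_gaussianReal, mul_zero])
    (fun i => by
      have hm : Measurable fun x : ℝ => ENNReal.ofReal (phi α (L i) |x|) := by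
        have := measurable_phiExp α (L i)
        simp_rw [phi_eq]
        fun_prop
      rw [hν, lintegral_map hm (hsm i)]
      exact lintegral_phi_gaussian_le hα hα2)
  refine le_trans ?_ hlow
  have hpi : Measure.pi ν =
      (Measure.pi fun _ : Fin n => gaussianReal 0 1).map fun x i => c * Lbar L i * x i :=
    (Measure.pi_map_pi fun i => (hsm i).aemeasurable).symm
  have hpm : Measurable fun (x : Fin n → ℝ) i => c * Lbar L i * x i :=
    measurable_pi_lambda _ fun i => (hsm i).comp (measurable_pi_apply i)
  have hnorm : eLpNorm (fun x : Fin n → ℝ => ∑ i, a i * x i) (ENNReal.ofReal p) (Measure.pi ν) =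
      ENNReal.ofReal (c * D) *
        eLpNorm (fun x : ℝ => x) (ENNReal.ofReal p) (gaussianReal 0 1) := by
    rw [hpi, eLpNorm_map_measure (measurable_linear_pi a).aestronglyMeasurable
      hpm.aemeasurable]
    have h1 : (fun x : Fin n → ℝ => ∑ i, a i * x i) ∘ (fun x i => c * Lbar L i * x i) =
        c • (fun x : Fin n → ℝ => ∑ i, a i * Lbar L i * x i) := by
      ext x
      simp only [Function.comp_apply, Pi.smul_apply, smul_eq_mul, Finset.mul_sum]
      exact Finset.sum_congr rfl fun i _ => by ring
    have h2 : eLpNorm (fun x : Fin n → ℝ => ∑ i, a i * Lbar L i * x i) (ENNReal.ofReal p)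
        (Measure.pi fun _ : Fin n => gaussianReal 0 1) =
        eLpNorm (fun x : ℝ => x) (ENNReal.ofReal p) ((gaussianReal 0 1).map fun x => D * x) := by
      rw [hD, ← map_pi_gaussianReal_sum, eLpNorm_map_measure (by fun_prop)
        (measurable_linear_pi _).aemeasurable]
      rfl
    have h3 : (fun x : ℝ => x) ∘ (fun x => D * x) = D • fun x : ℝ => x := rfl
    rw [h1, eLpNorm_const_smul, h2, eLpNorm_map_measure (by fun_prop) (by fun_prop), h3,
      eLpNorm_const_smul, Real.enorm_of_nonneg hc0, Real.enorm_of_nonneg hD0, ← mul_assoc,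
      ENNReal.ofReal_mul hc0]
  rw [hnorm]
  calc _ = ENNReal.ofReal (c * D) * ENNReal.ofReal (Real.exp (-4) * Real.sqrt p) := by
        rw [← ENNReal.ofReal_mul (by positivity)]; congr 1; ring
    _ ≤ _ := by gcongr; exact ofReal_le_eLpNorm_gaussianReal hp

lemma upperConst_pos {α : ℝ} (hα : 0 < α) : 0 < upperConst α := by
  unfold upperConst
  positivity

end GBO

/-! ### The two-sided bound -/

theorem theorem1 (α : ℝ) (hα : 0 < α) :
    ∃ C : ℝ, 0 < C ∧
      ∀ (n : ℕ) (L a : Fin n → ℝ), (∀ i, 0 ≤ L i) → (∀ i, 0 ≤ a i) →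
        Antitone (fun i => a i * GBO.Lbar L i) →
        ∀ p : ℝ, 1 ≤ p →
          GBO.worstMoment.{u} α L a p ≤ ENNReal.ofReal (C * GBO.momentBound α L a p) ∧
          (α ≤ 2 →
            ENNReal.ofReal (1 / C * GBO.momentBound α L a p) ≤ GBO.worstMoment.{u} α L a p) := by
  set c₁ : ℝ := (1 / 8) ^ (1 / α) * Real.exp (-4) with hc₁
  set c₂ : ℝ := 1 / (2 * Real.exp 1) with hc₂
  have h₁ : 0 < c₁ := by positivity
  have h₂ : 0 < c₂ := by positivity
  have h₀ := GBO.upperConst_pos hα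
  have hC : 0 < GBO.upperConst α + 1 / c₁ + 1 / c₂ := by positivity
  -- This C dominates the upper constant, while 1/C lies below both lower constants c₁ and c₂.
  refine ⟨GBO.upperConst α + 1 / c₁ + 1 / c₂, hC, fun n L a hL ha hA p hp => ⟨?_, fun hα2 => ?_⟩⟩
  · refine (GBO.worstMoment_le hα hL ha hA hp).trans (ENNReal.ofReal_le_ofReal ?_)
    refine mul_le_mul_of_nonneg_right ?_ GBO.momentBound_nonneg
    have : 0 < 1 / c₁ := by positivity
    have : 0 < 1 / c₂ := by positivity
    linarith
  · have hinv : ∀ c : ℝ, 0 < c → 1 / c ≤ GBO.upperConst α + 1 / c₁ + 1 / c₂ →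
        1 / (GBO.upperConst α + 1 / c₁ + 1 / c₂) ≤ c := fun c hc h => by
      rwa [one_div_le hC hc]
    have hi₁ := hinv c₁ h₁ (by have : 0 < 1 / c₂ := by positivity
                               linarith)
    have hi₂ := hinv c₂ h₂ (by have : 0 < 1 / c₁ := by positivity
                               linarith)
    have hn₂ : 0 ≤ GBO.vecNorm 2 (fun i => a i * GBO.Lbar L i) := GBO.vecNorm_nonneg (by norm_num) _
    have hnN : 0 ≤ GBO.vecNorm (GBO.conjExp α) (GBO.heavyPart α L a p) :=
      GBO.vecNorm_nonneg GBO.one_le_conjExp _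
    have hp0 : 0 ≤ p := by linarith
    -- M equals one of its two entries, so the family adapted to that entry suffices.
    rcases max_choice (Real.sqrt p * GBO.vecNorm 2 (fun i => a i * GBO.Lbar L i))
      (p ^ (1 / α) * GBO.vecNorm (GBO.conjExp α) (GBO.heavyPart α L a p)) with h | h
    · rw [GBO.momentBound, h]
      refine le_trans (ENNReal.ofReal_le_ofReal ?_) (GBO.gaussian_le_worstMoment hα hα2 hp)
      exact mul_le_mul_of_nonneg_right hi₁ (by positivity)
    · rw [GBO.momentBound, h]
      refine le_trans (ENNReal.ofReal_le_ofReal ?_) (GBO.weibull_le_worstMoment hα hL ha hp)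
      exact mul_le_mul_of_nonneg_right hi₂ (by positivity)
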